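/- Let $d\ge 2$ and $m=\lfloor d/2\rfloor$. For $\sigma\in\mathfrak S_d$ let $N(\sigma)$ be the least number of transpositions whose product is $\sigma$. Let $\mathrm{gr}^N\mathbb Q[\mathfrak S_d]$ be the associated graded algebra of the group algebra with respect to the norm filtration: it has $\mathbb Q$-basis $\{[\sigma] : \sigma\in\mathfrak S_d\}$ and product $[\sigma][\tau]=[\sigma\tau]$ if $N(\sigma\tau)=N(\sigma)+N(\tau)$ and $[\sigma][\tau]=0$ otherwise. Let $\mathcal A(d)\subseteq \mathrm{gr}^N\mathbb Q[\mathfrak S_d]$ be the (commutative) subalgebra of conjugation-invariant elements. For $1\le i\le m$ let $\delta_i\in\mathcal A(d)$ be the sum of all $[\sigma]$ with $\sigma$ a product of $i$ disjoint transpositions. Grade $\mathbb Q[X_1,\dots,X_m]$ by giving $X_i$ norm $i$, let $\mathbb Q[X_1,\dots,X_m]_+$ be the ideal of polynomials without constant term, let $\phi\colon\mathbb Q[X_1,\dots,X_m]\to\mathcal A(d)$ be the homomorphism of $\mathbb Q$-algebras with $X_i\mapsto\delta_i$, and let $I_d=\ker\phi$. A set of minimal relations is a graded basis of the graded vector space $I_d/(\mathbb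 Q[X_1,\dots,X_m]_+\cdot I_d)$, so that the number of minimal relations in norm $n$ is $\dim_{\mathbb Q}\bigl(I_d/(\mathbb Q[X_1,\dots,X_m]_+\cdot I_d)\bigr)_n$. 1. Let $d=2m\ge 2$. Then $\phi$ is surjective, the least norm in which there is a minimal relation is $m+1$, and there is exactly one minimal relation in norm $m+1$. 2. Let $d=2m+1\ge 5$. Then $\phi$ is surjective, the least norm in which there is a minimal relation is $m+2$, and there are exactly two minimal relations in norm $m+2$. -/

import Mathlib

namespace SymGraded

open Equiv

/-- The norm `N(σ)` of a permutation: the smallest number of transpositions whose product is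
`σ`. -/
noncomputable def norm {d : ℕ} (σ : Perm (Fin d)) : ℕ :=
  sInf {n | ∃ l : List (Perm (Fin d)), l.length = n ∧ (∀ τ ∈ l, τ.IsSwap) ∧ l.prod = σ}

theorem exists_factorisation {d : ℕ} (σ : Perm (Fin d)) :
    ∃ l : List (Perm (Fin d)), l.length = norm σ ∧ (∀ τ ∈ l, τ.IsSwap) ∧ l.prod = σ := by
  have h : {n | ∃ l : List (Perm (Fin d)), l.length = n ∧ (∀ τ ∈ l, τ.IsSwap) ∧
      l.prod = σ}.Nonempty :=
    ⟨_, (Perm.swapFactors σ).1, rfl, (Perm.swapFactors σ).2.2, (Perm.swapFactors σ).2.1⟩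
  exact Nat.sInf_mem h

theorem norm_le {d : ℕ} {σ : Perm (Fin d)} (l : List (Perm (Fin d)))
    (hl : ∀ τ ∈ l, τ.IsSwap) (h : l.prod = σ) : norm σ ≤ l.length :=
  Nat.sInf_le ⟨l, rfl, hl, h⟩

theorem norm_one {d : ℕ} : norm (1 : Perm (Fin d)) = 0 :=
  Nat.le_zero.mp (norm_le [] (by simp) rfl)

theorem norm_mul_le {d : ℕ} (σ τ : Perm (Fin d)) : norm (σ * τ) ≤ norm σ + norm τ := by
  obtain ⟨k, hk, hks, rfl⟩ := exists_factorisation σ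
  obtain ⟨l, hl, hls, rfl⟩ := exists_factorisation τ
  rw [← hk, ← hl, ← List.length_append, ← List.prod_append]
  refine norm_le _ (fun ρ hρ => ?_) rfl
  rcases List.mem_append.mp hρ with h | h
  · exact hks _ h
  · exact hls _ h

theorem norm_conj_le {d : ℕ} (σ τ : Perm (Fin d)) : norm (τ * σ * τ⁻¹) ≤ norm σ := by
  obtain ⟨k, hk, hks, hp⟩ := exists_factorisation σ
  rw [← hk, ← List.length_map (f := MulAut.conj τ)]
  refine norm_le _ (fun ρ hρ => ?_) ?_
  · obtain ⟨π, hπ, rfl⟩ := List.mem_map.mp hρ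
    obtain ⟨x, y, hxy, rfl⟩ := hks _ hπ
    refine ⟨τ x, τ y, fun h => hxy (τ.injective h), ?_⟩
    rw [MulAut.conj_apply, Equiv.swap_apply_apply]
  · rw [← map_list_prod, hp, MulAut.conj_apply]

theorem norm_conj {d : ℕ} (σ τ : Perm (Fin d)) : norm (τ * σ * τ⁻¹) = norm σ := by
  refine le_antisymm (norm_conj_le σ τ) ?_
  have h := norm_conj_le (τ * σ * τ⁻¹) τ⁻¹
  rwa [show τ⁻¹ * (τ * σ * τ⁻¹) * τ⁻¹⁻¹ = σ by group] at h

/-- The associated graded algebra of the rational group algebra of the symmetric group `𝔖_d`,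
with respect to the filtration by the norm. It has the classes `[σ]` as a basis, so an element is
given by its coefficients; the product is `[σ] * [τ] = [σ * τ]` if
`N (σ * τ) = N σ + N τ`, and `[σ] * [τ] = 0` otherwise (see `bracket_mul_bracket`). -/
def Gr (d : ℕ) : Type := Perm (Fin d) → ℚ

namespace Gr

variable {d : ℕ}

instance : AddCommGroup (Gr d) := inferInstanceAs (AddCommGroup (Perm (Fin d) → ℚ))

instance : Module ℚ (Gr d) := inferInstanceAs (Module ℚ (Perm (Fin d) → ℚ))

noncomputable instance : One (Gr d) := ⟨fun σ => if σ = 1 then 1 else 0⟩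

noncomputable instance : Mul (Gr d) :=
  ⟨fun f g ρ => ∑ σ, ∑ τ, if σ * τ = ρ ∧ norm (σ * τ) = norm σ + norm τ then f σ * g τ else 0⟩

theorem mul_apply (f g : Gr d) (ρ : Perm (Fin d)) : (f * g) ρ =
    ∑ σ, ∑ τ, if σ * τ = ρ ∧ norm (σ * τ) = norm σ + norm τ then f σ * g τ else 0 := rfl

theorem one_apply (σ : Perm (Fin d)) : (1 : Gr d) σ = if σ = 1 then 1 else 0 := rfl

theorem add_apply (f g : Gr d) (σ : Perm (Fin d)) : (f + g) σ = f σ + g σ := rfl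

theorem zero_apply (σ : Perm (Fin d)) : (0 : Gr d) σ = 0 := rfl

theorem smul_apply (c : ℚ) (f : Gr d) (σ : Perm (Fin d)) : (c • f) σ = c * f σ := rfl

@[ext] theorem ext {f g : Gr d} (h : ∀ σ, f σ = g σ) : f = g := funext h

/-- The basis element `[σ]`. -/
noncomputable def bracket (σ : Perm (Fin d)) : Gr d := fun ρ => if ρ = σ then 1 else 0

theorem bracket_mul_bracket (σ τ : Perm (Fin d)) :
    bracket σ * bracket τ =
      if norm (σ * τ) = norm σ + norm τ then bracket (σ * τ) else 0 := by
  ext ρ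
  rw [mul_apply, Finset.sum_eq_single σ, Finset.sum_eq_single τ]
  · by_cases h : norm (σ * τ) = norm σ + norm τ
    · simp [bracket, h, eq_comm]
    · simp [h, zero_apply]
  · intro b _ hb
    simp [bracket, hb]
  · simp
  · intro b _ hb
    simp [bracket, hb]
  · simp

/-- The structure constant of the product `[σ] * [τ]`. -/
noncomputable def coef (σ τ : Perm (Fin d)) : ℚ :=
  if norm (σ * τ) = norm σ + norm τ then 1 else 0

theorem coef_assoc (σ τ ρ : Perm (Fin d)) :
    coef σ τ * coef (σ * τ) ρ = coef τ ρ * coef σ (τ * ρ) := by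
  have h1 := norm_mul_le σ τ
  have h2 := norm_mul_le τ ρ
  have h3 := norm_mul_le (σ * τ) ρ
  have h4 := norm_mul_le σ (τ * ρ)
  simp only [coef, ← ite_and, mul_ite, mul_one, mul_zero]
  rw [mul_assoc] at *
  refine if_congr ?_ rfl rfl
  omega

theorem mul_apply' (f g : Gr d) (ρ : Perm (Fin d)) :
    (f * g) ρ = ∑ σ, coef σ (σ⁻¹ * ρ) * (f σ * g (σ⁻¹ * ρ)) := by
  rw [mul_apply]
  refine Finset.sum_congr rfl fun σ _ => ?_
  rw [Finset.sum_eq_single (σ⁻¹ * ρ)]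
  · simp [coef]
  · intro τ _ h
    rw [if_neg]
    rintro ⟨rfl, -⟩
    exact h (by simp)
  · simp

theorem mul_assoc' (f g h : Gr d) : f * g * h = f * (g * h) := by
  ext ρ
  rw [mul_apply' (f * g), mul_apply' f]
  simp only [mul_apply' f g, mul_apply' g h, Finset.mul_sum, Finset.sum_mul]
  rw [Finset.sum_comm]
  refine Finset.sum_congr rfl fun σ _ => ?_
  rw [← Equiv.sum_comp (Equiv.mulLeft σ)]
  refine Finset.sum_congr rfl fun τ _ => ?_
  have key := coef_assoc σ τ (τ⁻¹ * (σ⁻¹ * ρ))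
  simp only [Equiv.coe_mulLeft, mul_inv_rev, mul_assoc, inv_mul_cancel_left,
    mul_inv_cancel_left] at key ⊢
  linear_combination (f σ * g τ * h (τ⁻¹ * (σ⁻¹ * ρ))) * key

noncomputable instance : Ring (Gr d) where
  __ := (inferInstance : AddCommGroup (Gr d))
  mul_assoc := mul_assoc'
  one_mul f := by
    ext ρ
    rw [mul_apply', Finset.sum_eq_single 1]
    · simp [coef, norm_one, one_apply]
    · intro σ _ h
      simp [one_apply, h]
    · simp
  mul_one f := by
    ext ρ
    rw [mul_apply', Finset.sum_eq_single ρ]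
    · simp [coef, norm_one, one_apply]
    · intro σ _ h
      have : σ⁻¹ * ρ ≠ 1 := fun h' => h (inv_mul_eq_one.mp h')
      simp [one_apply, this]
    · simp
  left_distrib f g h := by
    ext ρ
    simp only [mul_apply', add_apply, mul_add, Finset.sum_add_distrib]
  right_distrib f g h := by
    ext ρ
    simp only [mul_apply', add_apply, add_mul, mul_add, Finset.sum_add_distrib]
  zero_mul f := by
    ext ρ
    simp [mul_apply', zero_apply]
  mul_zero f := by
    ext ρ
    simp [mul_apply', zero_apply]

noncomputable instance : Algebra ℚ (Gr d) :=
  Algebra.ofModule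
    (fun c f g => by
      ext ρ
      simp only [mul_apply', smul_apply, Finset.mul_sum]
      exact Finset.sum_congr rfl fun σ _ => by ring)
    (fun c f g => by
      ext ρ
      simp only [mul_apply', smul_apply, Finset.mul_sum]
      exact Finset.sum_congr rfl fun σ _ => by ring)

theorem coef_conj (σ τ π : Perm (Fin d)) :
    coef (π * σ * π⁻¹) (π * τ * π⁻¹) = coef σ τ := by
  simp only [coef, norm_conj]
  rw [show π * σ * π⁻¹ * (π * τ * π⁻¹) = π * (σ * τ) * π⁻¹ by group, norm_conj]

end Gr

/-- The algebra `A(d)`: the subalgebra of conjugation invariant elements of the associated graded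
algebra of `ℚ[𝔖_d]`. -/
noncomputable def A (d : ℕ) : Subalgebra ℚ (Gr d) where
  carrier := {f | ∀ σ τ : Perm (Fin d), f (τ * σ * τ⁻¹) = f σ}
  mul_mem' {f g} hf hg := fun ρ π => by
    rw [Gr.mul_apply', Gr.mul_apply', ← Equiv.sum_comp (MulAut.conj π).toEquiv]
    refine Finset.sum_congr rfl fun σ _ => ?_
    have e : (π * σ * π⁻¹)⁻¹ * (π * ρ * π⁻¹) = π * (σ⁻¹ * ρ) * π⁻¹ := by group
    simp only [MulEquiv.toEquiv_eq_coe, MulEquiv.coe_toEquiv, MulAut.conj_apply]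
    rw [e, Gr.coef_conj, hf, hg]
  add_mem' {f g} hf hg := fun σ τ => by rw [Gr.add_apply, Gr.add_apply, hf, hg]
  algebraMap_mem' c := fun σ τ => by
    rw [Algebra.algebraMap_eq_smul_one, Gr.smul_apply, Gr.smul_apply, Gr.one_apply, Gr.one_apply]
    simp only [conj_eq_one_iff]

noncomputable instance (d : ℕ) : CommRing (A d) where
  __ := (inferInstance : Ring (A d))
  mul_comm := by
    rintro ⟨f, hf⟩ ⟨g, hg⟩
    refine Subtype.ext (Gr.ext fun ρ => ?_)
    change (f * g) ρ = (g * f) ρ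
    rw [Gr.mul_apply', Gr.mul_apply', ← Equiv.sum_comp ((Equiv.inv _).trans (Equiv.mulLeft ρ))]
    refine Finset.sum_congr rfl fun σ _ => ?_
    have h1 : (ρ * σ⁻¹)⁻¹ * ρ = σ := by group
    have h2 : σ * (σ⁻¹ * ρ) * σ⁻¹ = ρ * σ⁻¹ := by group
    have hc : Gr.coef (ρ * σ⁻¹) σ = Gr.coef σ (σ⁻¹ * ρ) := by
      have hn := norm_conj (σ⁻¹ * ρ) σ
      rw [h2] at hn
      simp only [Gr.coef, hn, inv_mul_cancel_right, mul_inv_cancel_left]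
      rw [add_comm]
    have hff := hf (σ⁻¹ * ρ) σ
    rw [h2] at hff
    simp only [Equiv.trans_apply, Equiv.inv_apply, Equiv.coe_mulLeft]
    rw [h1, hc, hff, mul_comm (f _)]

/-- The element `δ_i(d)` of `A(d)`: the sum of the `[σ]` over all permutations `σ` that are
products of `i` disjoint transpositions. -/
noncomputable def delta (d i : ℕ) : A d :=
  ⟨∑ σ : Perm (Fin d) with σ.cycleType = Multiset.replicate i 2, Gr.bracket σ, fun σ τ => by
    have h : ∀ ρ : Perm (Fin d),
        (∑ σ : Perm (Fin d) with σ.cycleType = Multiset.replicate i 2, Gr.bracket σ : Gr d) ρ =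
          if ρ.cycleType = Multiset.replicate i 2 then 1 else 0 := fun ρ => by
      have h' : ∀ s : Finset (Perm (Fin d)),
          (∑ σ ∈ s, Gr.bracket σ : Gr d) ρ = if ρ ∈ s then 1 else 0 := fun s => by
        induction s using Finset.induction_on with
        | empty => simp [Gr.zero_apply]
        | insert a s ha ih =>
          rw [Finset.sum_insert ha, Gr.add_apply, ih]
          by_cases hr : ρ = a
          · subst hr
            simp [Gr.bracket, ha]
          · simp [Gr.bracket, hr]
      rw [h']
      simp
    rw [h, h, Perm.cycleType_conj]⟩

/-- The polynomial algebra `ℚ[X_1, …, X_m]` with `m = ⌊d/2⌋`; the variable `X_{k+1}` has the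
index `k : Fin (d / 2)`. -/
abbrev Poly (d : ℕ) : Type := MvPolynomial (Fin (d / 2)) ℚ

/-- The norm of the variables: `X_i` has norm `i`. -/
def weight (d : ℕ) (k : Fin (d / 2)) : ℕ := k + 1

/-- The homomorphism `ℚ[X_1, …, X_m] → A(d)` sending `X_i` to `δ_i(d)`. -/
noncomputable def presentation (d : ℕ) : Poly d →ₐ[ℚ] A d :=
  MvPolynomial.aeval fun k => delta d (k + 1)

/-- The ideal `I_d` of relations. -/
noncomputable def relations (d : ℕ) : Ideal (Poly d) :=
  RingHom.ker (presentation d)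

/-- The ideal `ℚ[X_1, …, X_m]_+` of polynomials without constant term. -/
noncomputable def positive (d : ℕ) : Ideal (Poly d) :=
  RingHom.ker (MvPolynomial.constantCoeff : Poly d →+* ℚ)

/-- The module `I_d / ℚ[X_1, …, X_m]_+ I_d`; a set of minimal relations for `A(d)` is a graded
basis of this graded vector space. -/
abbrev MinimalRelations (d : ℕ) : Type :=
  relations d ⧸ (positive d • (⊤ : Submodule (Poly d) (relations d)))

/-- The part of norm `n` of `I_d / ℚ[X_1, …, X_m]_+ I_d`: the classes of the relations that are
homogeneous of norm `n`. Its dimension is the number of minimal relations in norm `n`. -/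
noncomputable def minimalRelations (d n : ℕ) : Submodule ℚ (MinimalRelations d) :=
  ((MvPolynomial.weightedHomogeneousSubmodule ℚ (weight d) n).comap
    ((relations d).subtype.restrictScalars ℚ)).map
      ((positive d • (⊤ : Submodule (Poly d) (relations d))).mkQ.restrictScalars ℚ)

end SymGraded

/-! Everything reduces to surjectivity of `presentation` and a partition count. Write I for the
ideal of relations. Once the map is onto, dim I_n is a difference of two dimensions. Monomials of
norm n are partitions of n with parts at most m. Invariants of norm n have the class sums as basis,
and lowering every cycle length by one turns these into partitions p of n with n + length(p) ≤ d.
Passing to complements, dim I_n plus the number of partitions with a part exceeding m equals the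
number of partitions with n + length > d (`finrank_homogeneousRelations_add_card`). Near the lowest
norms both counts are tiny: 2 − 1 = 1 for d = 2m, n = m + 1; 1 − 1 = 0 and 4 − 2 = 2 for d = 2m + 1,
n = m + 1 and m + 2. In the lowest norm where I is nonzero nothing is decomposable, so minimal
relations there are all relations (`finrank_minimalRelations`).

Surjectivity rests on an identity for Jucys–Murphy elements. Let M be the sum of all involutions, so
that its norm components are the δ_i. Adding one point v multiplies M by f(J_v), where J_v is the
sum of the transpositions joining v to earlier points and f² = f + X
(`matching_insert_eq_eval_mul`). Applying the Euler derivation to the resulting product gives a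
Newton identity between the δ_i and the power sums of the J_v, with weights the coefficients of X
f'/f. For n ≥ 1 these are, up to sign, half the central binomial coefficients, hence nonzero, so
every power sum is a polynomial in the δ_i (`powerSum_mem_range`).

The n-th power sum is a positive combination of (n+1)-cycles. Multiplying it by the class sum of the
remaining cycles gives a positive multiple of the desired class sum plus classes with fewer cycles,
and induction on the number of cycles finishes (`classSum_mem_range`). -/

namespace SymGraded

open Equiv

/-! ### The norm as support size minus number of cycles -/

section Norm

variable {d : ℕ}

theorem norm_add_card_cycleType_le_card_support (σ : Perm (Fin d)) :
    norm σ + σ.cycleType.card ≤ σ.support.card := by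
  induction σ using Perm.cycle_induction_on with
  | base_one => simp [norm_one]
  | base_cycles σ hσ =>
    obtain ⟨x, hx, hc⟩ := id hσ
    have hx' : x ∈ σ.support := Perm.mem_support.mpr hx
    have h := Perm.IsCycle.cycleOf_eq (f := σ) ⟨x, hx, hc⟩ hx
    have hlen : (Perm.toList σ x).length = σ.support.card := by
      rw [Perm.length_toList, h]
    have hnodup := Perm.nodup_toList σ x
    have hform : (Perm.toList σ x).formPerm = σ := by rw [Perm.formPerm_toList, h]
    -- A cycle on r points is a product of r − 1 transpositions of consecutive entries.
    have key : ∀ l : List (Fin d), l.Nodup → norm l.formPerm ≤ l.length - 1 := by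
      intro l
      induction l with
      | nil => simp [norm_one]
      | cons a l ih =>
        intro hl
        cases l with
        | nil => simp [norm_one]
        | cons b l =>
          rw [List.formPerm_cons_cons]
          have h1 := ih hl.of_cons
          have hab : a ≠ b := by
            rintro rfl
            simp at hl
          have h2 : norm (swap a b) ≤ 1 :=
            norm_le [swap a b] (by simpa using ⟨a, b, hab, rfl⟩) (by simp)
          have h3 := norm_mul_le (swap a b) (b :: l).formPerm
          simp only [List.length_cons] at *
          omega
    have h1 := key _ hnodup
    rw [hform, hlen] at h1
    have h2 : 0 < σ.support.card := Finset.card_pos.mpr ⟨x, hx'⟩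
    rw [Perm.card_cycleType_eq_one.mpr hσ]
    omega
  | induction_disjoint σ τ hd _ h1 h2 =>
    have h3 := norm_mul_le σ τ
    rw [hd.card_support_mul, hd.cycleType_mul, Multiset.card_add]
    omega

theorem exists_cycle_representatives (σ : Perm (Fin d)) :
    ∃ R : Finset (Fin d), R.card + σ.support.card ≤ d + σ.cycleType.card ∧
      ∀ x, ∃ y ∈ R, σ.SameCycle x y := by
  have hc : ∀ c ∈ σ.cycleFactorsFinset, ∃ x, x ∈ c.support := fun c h => by
    obtain ⟨x, hx, -⟩ := (Perm.mem_cycleFactorsFinset_iff.mp h).1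
    exact ⟨x, Perm.mem_support.mpr hx⟩
  choose r hr using hc
  let I : Finset (Fin d) := σ.cycleFactorsFinset.attach.image fun c => r c.1 c.2
  refine ⟨σ.supportᶜ ∪ I, ?_, fun x => ?_⟩
  · have h1 := Finset.card_union_le σ.supportᶜ I
    have h2 : I.card ≤ σ.cycleType.card := by
      rw [Perm.cycleType_def, Multiset.card_map]
      exact Finset.card_image_le.trans_eq Finset.card_attach
    have h3 : σ.supportᶜ.card + σ.support.card = d := by
      rw [Finset.card_compl_add_card, Fintype.card_fin]
    omega
  · by_cases hx : x ∈ σ.support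
    · have hmem := Perm.cycleOf_mem_cycleFactorsFinset_iff.mpr hx
      refine ⟨r _ hmem, Finset.mem_union_right _ ?_,
        (Perm.mem_support_cycleOf_iff.mp (hr _ hmem)).1⟩
      exact Finset.mem_image.mpr ⟨⟨_, hmem⟩, Finset.mem_attach _ _, rfl⟩
    · exact ⟨x, Finset.mem_union_left _ (Finset.mem_compl.mpr hx), Perm.SameCycle.refl _ _⟩

/-- A dimension count. A function on `Fin d` that agrees across every transposition of the list is
constant on the cycles of the product, so it vanishes once it vanishes on cycle representatives.
Hence d is at most the number of transpositions plus the number of representatives, fixed points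
being counted as cycles. -/
theorem card_support_le_length_add_card_cycleType (l : List (Perm (Fin d)))
    (hl : ∀ τ ∈ l, τ.IsSwap) : l.prod.support.card ≤ l.length + l.prod.cycleType.card := by
  obtain ⟨R, hR, hrep⟩ := exists_cycle_representatives l.prod
  have hs : ∀ i : Fin l.length, ∃ p : Fin d × Fin d, l[i] = swap p.1 p.2 := fun i => by
    obtain ⟨x, y, -, h⟩ := hl l[i] (List.getElem_mem _)
    exact ⟨(x, y), h⟩
  choose p hp using hs
  let F : (Fin d → ℚ) →ₗ[ℚ] (Fin l.length → ℚ) × (R → ℚ) :=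
    LinearMap.prod
      (LinearMap.funLeft ℚ ℚ (fun i => (p i).1) - LinearMap.funLeft ℚ ℚ (fun i => (p i).2))
      (LinearMap.funLeft ℚ ℚ Subtype.val)
  have hF : Function.Injective F := by
    rw [← LinearMap.ker_eq_bot, LinearMap.ker_eq_bot']
    intro f hf
    have h1 : ∀ i, f (p i).1 = f (p i).2 := fun i => by
      have := congrFun (congrArg Prod.fst hf) i
      simpa [F, sub_eq_zero] using this
    have h2 : ∀ x ∈ R, f x = 0 := fun x hx => congrFun (congrArg Prod.snd hf) ⟨x, hx⟩
    have h3 : ∀ τ ∈ l, ∀ x, f (τ x) = f x := by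
      intro τ hτ x
      obtain ⟨i, hi, rfl⟩ := List.getElem_of_mem hτ
      have := hp ⟨i, hi⟩
      have h := h1 ⟨i, hi⟩
      simp only [Fin.getElem_fin] at this
      rw [this, swap_apply_def]
      split_ifs with ha hb
      · rw [ha, h]
      · rw [hb, h]
      · rfl
    have h4 : ∀ l' : List (Perm (Fin d)), (∀ τ ∈ l', ∀ x, f (τ x) = f x) →
        ∀ x, f (l'.prod x) = f x := by
      intro l' h
      induction l' with
      | nil => simp
      | cons τ l' ih =>
        intro x
        rw [List.prod_cons, Perm.mul_apply, h τ (by simp),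
          ih fun τ hτ => h τ (List.mem_cons_of_mem _ hτ)]
    have h5 := h4 l h3
    funext x
    obtain ⟨y, hy, hxy⟩ := hrep x
    obtain ⟨n, -, hn⟩ := hxy.exists_pow_eq'
    rw [Pi.zero_apply, ← h2 y hy, ← hn]
    clear hn
    induction n with
    | zero => simp
    | succ n ih => rw [pow_succ', Perm.mul_apply, h5, ih]
  have := LinearMap.finrank_le_finrank_of_injective hF
  simp only [Module.finrank_prod, Module.finrank_fintype_fun_eq_card, Fintype.card_fin,
    Fintype.card_coe] at this
  omega

theorem norm_add_card_cycleType (σ : Perm (Fin d)) :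
    norm σ + σ.cycleType.card = σ.support.card := by
  refine le_antisymm (norm_add_card_cycleType_le_card_support σ) ?_
  obtain ⟨l, hl, hs, rfl⟩ := exists_factorisation σ
  rw [← hl]
  exact card_support_le_length_add_card_cycleType l hs

theorem norm_swap {x y : Fin d} (h : x ≠ y) : norm (swap x y) = 1 := by
  have := norm_add_card_cycleType (swap x y)
  rw [Perm.card_support_swap h, Perm.card_cycleType_eq_one.mpr (Perm.isCycle_swap h)] at this
  omega

theorem two_mul_card_cycleType_le (σ : Perm (Fin d)) :
    2 * σ.cycleType.card ≤ σ.support.card := by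
  rw [← Perm.sum_cycleType, mul_comm]
  exact Multiset.card_nsmul_le_sum fun x hx => Perm.two_le_of_mem_cycleType hx

theorem norm_eq_zero_iff {σ : Perm (Fin d)} : norm σ = 0 ↔ σ = 1 := by
  refine ⟨fun h => ?_, fun h => h ▸ norm_one⟩
  have h1 := norm_add_card_cycleType σ
  have h2 := two_mul_card_cycleType_le σ
  exact Perm.card_cycleType_eq_zero.mp (by omega)

theorem norm_le_card (σ : Perm (Fin d)) : norm σ ≤ d := by
  have h1 := norm_add_card_cycleType σ
  have h2 := Finset.card_le_univ σ.support
  rw [Fintype.card_fin] at h2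
  omega

theorem norm_mul_of_disjoint {σ τ : Perm (Fin d)} (h : σ.Disjoint τ) :
    norm (σ * τ) = norm σ + norm τ := by
  have h1 := norm_add_card_cycleType σ
  have h2 := norm_add_card_cycleType τ
  have h3 := norm_add_card_cycleType (σ * τ)
  rw [h.card_support_mul, h.cycleType_mul, Multiset.card_add] at h3
  omega

end Norm

/-! ### Positivity, grading and the Euler derivation on the graded algebra -/

namespace Gr

variable {d : ℕ}

theorem sum_apply {ι : Type*} (s : Finset ι) (f : ι → Gr d) (σ : Perm (Fin d)) :
    (∑ i ∈ s, f i) σ = ∑ i ∈ s, f i σ :=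
  Finset.sum_apply σ s f

theorem sub_apply (f g : Gr d) (σ : Perm (Fin d)) : (f - g) σ = f σ - g σ := rfl

theorem bracket_apply (σ ρ : Perm (Fin d)) : bracket σ ρ = if ρ = σ then 1 else 0 := rfl

theorem bracket_one : bracket (1 : Perm (Fin d)) = 1 := rfl

theorem bracket_mul_of_disjoint {σ τ : Perm (Fin d)} (h : σ.Disjoint τ) :
    bracket σ * bracket τ = bracket (σ * τ) := by
  rw [bracket_mul_bracket, if_pos (norm_mul_of_disjoint h)]

theorem bracket_mul_bracket_comm (σ τ : Perm (Fin d)) :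
    bracket σ * bracket τ = bracket τ * bracket (τ⁻¹ * σ * τ) := by
  have h := norm_conj σ τ⁻¹
  rw [inv_inv] at h
  rw [bracket_mul_bracket, bracket_mul_bracket, h, mul_assoc, mul_inv_cancel_left,
    add_comm (norm σ)]

theorem bracket_swap_mul_self {x y : Fin d} (h : x ≠ y) :
    bracket (swap x y) * bracket (swap x y) = 0 := by
  rw [bracket_mul_bracket, if_neg]
  rw [swap_mul_self, norm_one, norm_swap h]
  omega

theorem exists_of_mul_apply_ne_zero {f g : Gr d} {ρ : Perm (Fin d)} (h : (f * g) ρ ≠ 0) :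
    ∃ σ τ, σ * τ = ρ ∧ norm (σ * τ) = norm σ + norm τ ∧ f σ ≠ 0 ∧ g τ ≠ 0 := by
  rw [mul_apply] at h
  obtain ⟨σ, -, hσ⟩ := Finset.exists_ne_zero_of_sum_ne_zero h
  obtain ⟨τ, -, hτ⟩ := Finset.exists_ne_zero_of_sum_ne_zero hσ
  split_ifs at hτ with hc
  · exact ⟨σ, τ, hc.1, hc.2, left_ne_zero_of_mul hτ, right_ne_zero_of_mul hτ⟩
  · exact absurd rfl hτ

theorem mul_nonneg {f g : Gr d} (hf : ∀ σ, 0 ≤ f σ) (hg : ∀ σ, 0 ≤ g σ) (ρ : Perm (Fin d)) :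
    0 ≤ (f * g) ρ := by
  rw [mul_apply]
  refine Finset.sum_nonneg fun σ _ => Finset.sum_nonneg fun τ _ => ?_
  split_ifs
  · exact _root_.mul_nonneg (hf σ) (hg τ)
  · exact le_rfl

/-- Nonnegative coefficients cannot cancel, so one length-additive factorisation suffices. This
replaces any computation of structure constants below. -/
theorem mul_pos {f g : Gr d} (hf : ∀ σ, 0 ≤ f σ) (hg : ∀ σ, 0 ≤ g σ) {σ τ : Perm (Fin d)}
    (h : norm (σ * τ) = norm σ + norm τ) (hσ : 0 < f σ) (hτ : 0 < g τ) :
    0 < (f * g) (σ * τ) := by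
  have h0 : ∀ α β : Perm (Fin d), 0 ≤
      if α * β = σ * τ ∧ norm (α * β) = norm α + norm β then f α * g β else 0 := fun α β => by
    split_ifs
    · exact _root_.mul_nonneg (hf α) (hg β)
    · exact le_rfl
  rw [mul_apply]
  refine Finset.sum_pos' (fun α _ => Finset.sum_nonneg fun β _ => h0 α β) ⟨σ, Finset.mem_univ _,
    Finset.sum_pos' (fun β _ => h0 σ β) ⟨τ, Finset.mem_univ _, ?_⟩⟩
  rw [if_pos ⟨rfl, h⟩]
  exact _root_.mul_pos hσ hτ

theorem pow_nonneg {f : Gr d} (hf : ∀ σ, 0 ≤ f σ) (n : ℕ) (σ : Perm (Fin d)) : 0 ≤ (f ^ n) σ := by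
  induction n generalizing σ with
  | zero =>
    rw [pow_zero, one_apply]
    split_ifs <;> norm_num
  | succ n ih =>
    rw [pow_succ]
    exact mul_nonneg ih hf σ

/-- The elements of `Gr d` that are homogeneous of norm `n`. -/
def homogeneous (d n : ℕ) : Submodule ℚ (Gr d) where
  carrier := {f | ∀ σ, norm σ ≠ n → f σ = 0}
  add_mem' hf hg σ hσ := by rw [add_apply, hf σ hσ, hg σ hσ, add_zero]
  zero_mem' _ _ := rfl
  smul_mem' c f hf σ hσ := by rw [smul_apply, hf σ hσ, mul_zero]

theorem bracket_mem_homogeneous (σ : Perm (Fin d)) : bracket σ ∈ homogeneous d (norm σ) :=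
  fun _ h => if_neg fun h' => h (congrArg norm h')

theorem mul_mem_homogeneous {i j : ℕ} {f g : Gr d} (hf : f ∈ homogeneous d i)
    (hg : g ∈ homogeneous d j) : f * g ∈ homogeneous d (i + j) := by
  intro ρ hρ
  by_contra h
  obtain ⟨σ, τ, rfl, hn, h1, h2⟩ := exists_of_mul_apply_ne_zero h
  have h3 : norm σ = i := not_not.mp fun h => h1 (hf σ h)
  have h4 : norm τ = j := not_not.mp fun h => h2 (hg τ h)
  omega

theorem one_mem_homogeneous : (1 : Gr d) ∈ homogeneous d 0 := by
  have := bracket_mem_homogeneous (1 : Perm (Fin d))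
  rwa [norm_one] at this

theorem pow_mem_homogeneous {i : ℕ} {f : Gr d} (hf : f ∈ homogeneous d i) (n : ℕ) :
    f ^ n ∈ homogeneous d (n * i) := by
  induction n with
  | zero => simpa using one_mem_homogeneous
  | succ n ih =>
    rw [pow_succ, add_mul, one_mul]
    exact mul_mem_homogeneous ih hf

theorem eq_zero_of_mem_homogeneous {n : ℕ} (hn : d < n) {f : Gr d} (hf : f ∈ homogeneous d n) :
    f = 0 :=
  ext fun σ => hf σ ((norm_le_card σ).trans_lt hn).ne

/-- The component of norm `n`. -/
noncomputable def component (n : ℕ) : Gr d →ₗ[ℚ] Gr d where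
  toFun f σ := if norm σ = n then f σ else 0
  map_add' f g := by
    ext σ
    change (if _ then f σ + g σ else 0) = (if _ then f σ else 0) + (if _ then g σ else 0)
    split_ifs <;> simp
  map_smul' c f := by
    ext σ
    change (if _ then c * f σ else 0) = c * (if _ then f σ else 0)
    split_ifs <;> simp

theorem component_apply (n : ℕ) (f : Gr d) (σ : Perm (Fin d)) :
    component n f σ = if norm σ = n then f σ else 0 := rfl

theorem component_mem (n : ℕ) (f : Gr d) : component n f ∈ homogeneous d n :=
  fun _ h => if_neg h

theorem component_of_mem {i n : ℕ} {f : Gr d} (hf : f ∈ homogeneous d i) :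
    component n f = if i = n then f else 0 := by
  ext σ
  rw [component_apply]
  by_cases h : norm σ = i
  · rw [h]
    split_ifs <;> rfl
  · rw [hf σ h]
    split_ifs
    · exact (hf σ h).symm
    · rfl
    · exact (hf σ h).symm
    · rfl

theorem sum_component (f : Gr d) : ∑ n ∈ Finset.range (d + 1), component n f = f := by
  ext σ
  rw [sum_apply]
  simp only [component_apply]
  rw [Finset.sum_ite_eq, if_pos]
  exact Finset.mem_range_succ_iff.mpr (norm_le_card σ)

theorem component_mul (n : ℕ) (f g : Gr d) : component n (f * g) =
    ∑ p ∈ Finset.HasAntidiagonal.antidiagonal n, component p.1 f * component p.2 g := by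
  conv_lhs => rw [← sum_component f, ← sum_component g, Finset.sum_mul_sum, map_sum]
  simp only [map_sum]
  simp only [component_of_mem (mul_mem_homogeneous (component_mem _ f) (component_mem _ g))]
  rw [← Finset.sum_product', ← Finset.sum_filter]
  refine Finset.sum_subset_zero_on_sdiff (fun p hp => ?_) (fun p hp => ?_) fun _ _ => rfl
  · exact Finset.HasAntidiagonal.mem_antidiagonal.mpr (Finset.mem_filter.mp hp).2
  · simp only [Finset.mem_sdiff, Finset.HasAntidiagonal.mem_antidiagonal, Finset.mem_filter,
      Finset.mem_product, Finset.mem_range] at hp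
    by_cases h : p.1 < d + 1
    · rw [eq_zero_of_mem_homogeneous (n := p.2) (by by_contra; apply hp.2; omega)
        (component_mem _ g), mul_zero]
    · rw [eq_zero_of_mem_homogeneous (n := p.1) (by omega) (component_mem _ f), zero_mul]

/-- The Euler derivation, multiplying `[σ]` by its norm. -/
noncomputable def euler : Gr d →ₗ[ℚ] Gr d where
  toFun f σ := norm σ * f σ
  map_add' f g := by
    ext σ
    exact mul_add _ _ _
  map_smul' c f := by
    ext σ
    exact mul_left_comm _ _ _

theorem euler_apply (f : Gr d) (σ : Perm (Fin d)) : euler f σ = norm σ * f σ := rfl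

theorem euler_of_mem {n : ℕ} {f : Gr d} (hf : f ∈ homogeneous d n) : euler f = (n : ℚ) • f := by
  ext σ
  rw [euler_apply, smul_apply]
  by_cases h : norm σ = n
  · rw [h]
  · rw [hf σ h, mul_zero, mul_zero]

theorem euler_mul (f g : Gr d) : euler (f * g) = euler f * g + f * euler g := by
  ext ρ
  rw [add_apply, euler_apply, mul_apply, mul_apply, mul_apply, Finset.mul_sum,
    ← Finset.sum_add_distrib]
  refine Finset.sum_congr rfl fun σ _ => ?_
  rw [Finset.mul_sum, ← Finset.sum_add_distrib]
  refine Finset.sum_congr rfl fun τ _ => ?_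
  split_ifs with h
  · rw [← h.1, h.2, euler_apply, euler_apply]
    push_cast
    ring
  · simp

theorem component_euler (n : ℕ) (f : Gr d) :
    component n (euler f) = (n : ℚ) • component n f := by
  ext σ
  rw [component_apply, smul_apply, component_apply, euler_apply]
  split_ifs with h
  · rw [h]
  · rw [mul_zero]

/-! ### Power series in nilpotent elements -/

/-- The value of a power series at an element of positive norm. -/
noncomputable def eval (x : Gr d) : PowerSeries ℚ →ₗ[ℚ] Gr d :=
  (Polynomial.aeval x).toLinearMap ∘ₗ PowerSeries.trunc (d + 1)

theorem eval_eq_sum (x : Gr d) (p : PowerSeries ℚ) :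
    eval x p = ∑ n ∈ Finset.range (d + 1), PowerSeries.coeff n p • x ^ n := by
  change Polynomial.aeval x (PowerSeries.trunc (d + 1) p) = _
  rw [Polynomial.aeval_def, PowerSeries.eval₂_trunc_eq_sum_range]
  simp only [Algebra.smul_def]

theorem eval_one (x : Gr d) : eval x 1 = 1 := by
  change Polynomial.aeval x (PowerSeries.trunc (d + 1) 1) = _
  rw [PowerSeries.trunc_one, map_one]

theorem eval_X {x : Gr d} (hx : x ^ (d + 1) = 0) : eval x PowerSeries.X = x := by
  change Polynomial.aeval x (PowerSeries.trunc (d + 1) PowerSeries.X) = _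
  cases d with
  | zero =>
    rw [zero_add, pow_one] at hx
    simp [hx]
  | succ d => rw [PowerSeries.trunc_X, Polynomial.aeval_X]

theorem eval_mul {x : Gr d} (hx : x ^ (d + 1) = 0) (p q : PowerSeries ℚ) :
    eval x (p * q) = eval x p * eval x q := by
  change Polynomial.aeval x (PowerSeries.trunc (d + 1) (p * q)) =
    Polynomial.aeval x (PowerSeries.trunc (d + 1) p) *
      Polynomial.aeval x (PowerSeries.trunc (d + 1) q)
  rw [← map_mul, ← PowerSeries.trunc_trunc_mul_trunc, ← Polynomial.coe_mul]
  generalize PowerSeries.trunc (d + 1) p * PowerSeries.trunc (d + 1) q = r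
  -- Truncation changes a polynomial only by a multiple of X^(d+1), which is killed on evaluation at
  -- x.
  have hdvd : Polynomial.X ^ (d + 1) ∣ r - PowerSeries.trunc (d + 1) (r : PowerSeries ℚ) := by
    rw [Polynomial.X_pow_dvd_iff]
    intro n hn
    rw [Polynomial.coeff_sub, PowerSeries.coeff_trunc, if_pos hn, Polynomial.coeff_coe, sub_self]
  obtain ⟨s, hs⟩ := hdvd
  have := congrArg (Polynomial.aeval x) hs
  rw [map_sub, map_mul, map_pow, Polynomial.aeval_X, hx, zero_mul, sub_eq_zero] at this
  exact this.symm

theorem euler_eval {x : Gr d} (hx : x ∈ homogeneous d 1) (p : PowerSeries ℚ) :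
    euler (eval x p) = eval x (PowerSeries.X * PowerSeries.derivative ℚ p) := by
  rw [eval_eq_sum, eval_eq_sum, map_sum]
  refine Finset.sum_congr rfl fun n _ => ?_
  have h := pow_mem_homogeneous hx n
  rw [mul_one] at h
  rw [map_smul, euler_of_mem h, smul_smul]
  congr 1
  cases n with
  | zero => simp
  | succ n =>
    rw [PowerSeries.coeff_succ_X_mul, PowerSeries.coeff_derivative]
    push_cast
    ring

/-! ### Stars, matchings and the factorisation of the sum of involutions -/

/-- The sum of the transpositions `(k v)` with `k ∈ S`. -/
noncomputable def star (v : Fin d) (S : Finset (Fin d)) : Gr d :=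
  ∑ k ∈ S, bracket (swap k v)

/-- The involutions with support in `S`. -/
def involutions (S : Finset (Fin d)) : Finset (Perm (Fin d)) :=
  {σ | σ * σ = 1 ∧ ∀ x ∉ S, σ x = x}

theorem mem_involutions {S : Finset (Fin d)} {σ : Perm (Fin d)} :
    σ ∈ involutions S ↔ σ * σ = 1 ∧ ∀ x ∉ S, σ x = x := by
  simp [involutions]

/-- The sum of the involutions with support in `S`. -/
noncomputable def matching (S : Finset (Fin d)) : Gr d :=
  ∑ σ ∈ involutions S, bracket σ

theorem star_mem_homogeneous {v : Fin d} {S : Finset (Fin d)} (hv : v ∉ S) :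
    star v S ∈ homogeneous d 1 := by
  refine Submodule.sum_mem _ fun k hk => ?_
  have h : k ≠ v := fun h => hv (h ▸ hk)
  rw [← norm_swap h]
  exact bracket_mem_homogeneous _

theorem star_pow_mem_homogeneous {v : Fin d} {S : Finset (Fin d)} (hv : v ∉ S) (n : ℕ) :
    star v S ^ n ∈ homogeneous d n := by
  have := pow_mem_homogeneous (star_mem_homogeneous hv) n
  rwa [mul_one] at this

theorem star_pow_eq_zero {v : Fin d} {S : Finset (Fin d)} (hv : v ∉ S) :
    star v S ^ (d + 1) = 0 :=
  eq_zero_of_mem_homogeneous (Nat.lt_succ_self d) (star_pow_mem_homogeneous hv _)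

/-- Conjugation by (k v) turns (l v) into (l k); the term l = k drops out because a transposition
squares to zero in the graded algebra. -/
theorem star_mul_bracket_swap {v k : Fin d} {S : Finset (Fin d)} (hv : v ∉ S) (hk : k ∈ S) :
    star v S * bracket (swap k v) = bracket (swap k v) * star k (S.erase k) := by
  have hkv : k ≠ v := fun h => hv (h ▸ hk)
  rw [star, ← Finset.add_sum_erase _ _ hk, add_mul, bracket_swap_mul_self hkv, zero_add, star,
    Finset.sum_mul, Finset.mul_sum]
  refine Finset.sum_congr rfl fun l hl => ?_
  obtain ⟨hlk, hl⟩ := Finset.mem_erase.mp hl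
  have hlv : l ≠ v := fun h => hv (h ▸ hl)
  rw [bracket_mul_bracket_comm]
  have h := swap_apply_apply (swap k v) l v
  rw [swap_apply_of_ne_of_ne hlk hlv, swap_apply_right, swap_inv] at h
  rw [h, swap_inv]

theorem star_pow_mul_bracket_swap {v k : Fin d} {S : Finset (Fin d)} (hv : v ∉ S) (hk : k ∈ S)
    (n : ℕ) :
    star v S ^ n * bracket (swap k v) = bracket (swap k v) * star k (S.erase k) ^ n := by
  induction n with
  | zero => simp
  | succ n ih =>
    rw [pow_succ, mul_assoc, star_mul_bracket_swap hv hk, ← mul_assoc, ih, mul_assoc, ← pow_succ]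

theorem eval_star_mul_bracket_swap {v k : Fin d} {S : Finset (Fin d)} (hv : v ∉ S) (hk : k ∈ S)
    (p : PowerSeries ℚ) :
    eval (star v S) p * bracket (swap k v) =
      bracket (swap k v) * eval (star k (S.erase k)) p := by
  rw [eval_eq_sum, eval_eq_sum, Finset.sum_mul, Finset.mul_sum]
  refine Finset.sum_congr rfl fun n _ => ?_
  rw [smul_mul_assoc, mul_smul_comm, star_pow_mul_bracket_swap hv hk]

/-- An involution either fixes v or pairs it with some k in S; in the second case stripping off (k
v) leaves an involution supported in S without k. -/
theorem matching_insert {v : Fin d} {S : Finset (Fin d)} (hv : v ∉ S) :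
    matching (insert v S) =
      matching S + ∑ k ∈ S, bracket (swap k v) * matching (S.erase k) := by
  rw [matching, ← Finset.sum_filter_add_sum_filter_not _ (fun σ => σ v = v)]
  congr 1
  · refine Finset.sum_congr (Finset.ext fun σ => ?_) fun _ _ => rfl
    rw [Finset.mem_filter, mem_involutions, mem_involutions]
    constructor
    · rintro ⟨⟨h1, h2⟩, h3⟩
      refine ⟨h1, fun x hx => ?_⟩
      by_cases hxv : x = v
      · rw [hxv, h3]
      · exact h2 x (by simp [hx, hxv])
    · rintro ⟨h1, h2⟩
      exact ⟨⟨h1, fun x hx => h2 x fun h => hx (Finset.mem_insert_of_mem h)⟩, h2 v hv⟩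
  · rw [← Finset.sum_fiberwise_of_maps_to (t := S) (g := fun σ => σ v)]
    · refine Finset.sum_congr rfl fun k hk => ?_
      have hkv : k ≠ v := fun h => hv (h ▸ hk)
      have hdisj : ∀ τ ∈ involutions (S.erase k), (swap k v).Disjoint τ := by
        intro τ hτ x
        obtain ⟨h1, h2⟩ := mem_involutions.mp hτ
        by_cases hxk : x = k
        · exact Or.inr (h2 x (by simp [hxk]))
        by_cases hxv : x = v
        · exact Or.inr (h2 x (by simp [hxv, hv]))
        · exact Or.inl (swap_apply_of_ne_of_ne hxk hxv)
      have hmap : ∀ σ ∈ {σ ∈ {σ ∈ involutions (insert v S) | ¬σ v = v} | σ v = k},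
          swap k v * σ ∈ involutions (S.erase k) := by
        intro σ hσ
        rw [Finset.mem_filter, Finset.mem_filter, mem_involutions] at hσ
        obtain ⟨⟨⟨h1, h2⟩, -⟩, h4⟩ := hσ
        have h5 : σ k = v := by
          rw [← h4, ← Perm.mul_apply, h1, Perm.one_apply]
        have h6 : σ⁻¹ = σ := inv_eq_of_mul_eq_one_right h1
        have h7 := swap_apply_apply σ k v
        rw [h4, h5, h6, swap_comm] at h7
        rw [mem_involutions]
        refine ⟨?_, fun x hx => ?_⟩
        · calc swap k v * σ * (swap k v * σ) = swap k v * (σ * swap k v * σ) := by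
                simp only [mul_assoc]
            _ = 1 := by rw [← h7, swap_mul_self]
        · rw [Perm.mul_apply]
          by_cases hxk : x = k
          · rw [hxk, h5, swap_apply_right]
          by_cases hxv : x = v
          · rw [hxv, h4, swap_apply_left]
          · rw [h2 x, swap_apply_of_ne_of_ne hxk hxv]
            simp only [Finset.mem_erase, not_and] at hx
            simp [hxv, hx hxk]
      rw [matching, Finset.mul_sum]
      refine Finset.sum_nbij' (fun σ => swap k v * σ) (fun τ => swap k v * τ) ?_ ?_ ?_ ?_ ?_
      · exact hmap
      · intro τ hτ
        have hd := hdisj τ hτ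
        obtain ⟨h1, h2⟩ := mem_involutions.mp hτ
        have h3 : τ v = v := h2 v (by simp [hv])
        have h4 : (swap k v * τ) v = k := by rw [Perm.mul_apply, h3, swap_apply_right]
        rw [Finset.mem_filter, Finset.mem_filter, mem_involutions]
        refine ⟨⟨⟨?_, fun x hx => ?_⟩, by rw [h4]; exact hkv⟩, h4⟩
        · calc swap k v * τ * (swap k v * τ) = swap k v * (τ * swap k v) * τ := by
                simp only [mul_assoc]
            _ = 1 := by rw [← hd.commute.eq, ← mul_assoc, swap_mul_self, one_mul, h1]
        · rw [Finset.mem_insert, not_or] at hx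
          rw [Perm.mul_apply, h2 x fun h => hx.2 (Finset.mem_of_mem_erase h),
            swap_apply_of_ne_of_ne (fun h => hx.2 (by rwa [h])) hx.1]
      · intro σ _
        exact swap_mul_self_mul k v σ
      · intro τ _
        exact swap_mul_self_mul k v τ
      · intro σ hσ
        rw [bracket_mul_of_disjoint (hdisj _ (hmap σ hσ)), swap_mul_self_mul]
    · intro σ hσ
      rw [Finset.mem_filter, mem_involutions] at hσ
      obtain ⟨⟨h1, h2⟩, h3⟩ := hσ
      by_contra h
      have h4 : σ v ∉ insert v S := by simp [h, h3]
      exact h3 (σ.injective (h2 _ h4))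

/-- Induction for the smaller set S \ {k}, with k as the added point, expresses its matching sum as
h(J_k) times that of S, since h inverts f. Moving h past (k v) changes it to h(J_v), so the terms of
`matching_insert` add up to (1 + J_v h(J_v)) times the matching sum of S. -/
theorem matching_insert_eq_eval_mul {f h : PowerSeries ℚ} (hf : f = 1 + PowerSeries.X * h)
    (hfh : f * h = 1) {v : Fin d} {S : Finset (Fin d)} (hv : v ∉ S) :
    matching (insert v S) = eval (star v S) f * matching S := by
  induction S using Finset.strongInduction generalizing v with
  | H S ih =>
    have key : ∀ k ∈ S, matching (S.erase k) = eval (star k (S.erase k)) h * matching S := by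
      intro k hk
      have h1 := ih (S.erase k) (Finset.erase_ssubset hk) (Finset.notMem_erase k S)
      rw [Finset.insert_erase hk] at h1
      rw [h1, ← mul_assoc, ← eval_mul (star_pow_eq_zero (Finset.notMem_erase k S)), mul_comm h,
        hfh, eval_one, one_mul]
    have hX := eval_X (star_pow_eq_zero hv)
    rw [matching_insert hv, hf, map_add, eval_one, add_mul, one_mul, mul_comm PowerSeries.X,
      eval_mul (star_pow_eq_zero hv), hX]
    congr 1
    conv_rhs => rw [star, mul_assoc, Finset.sum_mul, Finset.mul_sum]
    refine Finset.sum_congr rfl fun k hk => ?_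
    rw [key k hk, ← mul_assoc, ← mul_assoc, ← star, eval_star_mul_bracket_swap hv hk]

/-- A permutation supported in S fixes v, so conjugation by it merely permutes the transpositions (k
v) with k in S. -/
theorem bracket_mul_star {v : Fin d} {S : Finset (Fin d)} (hv : v ∉ S) {σ : Perm (Fin d)}
    (hσ : ∀ x ∉ S, σ x = x) : bracket σ * star v S = star v S * bracket σ := by
  have hS : ∀ x, σ⁻¹ x ∈ S ↔ x ∈ S := by
    intro x
    by_cases hx : x ∈ S
    · refine iff_of_true (not_not.mp fun h => ?_) hx
      have := hσ _ h
      rw [← Perm.mul_apply, mul_inv_cancel, Perm.one_apply] at this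
      exact h (this ▸ hx)
    · refine iff_of_false (fun h => ?_) hx
      rw [Perm.inv_eq_iff_eq.mpr (hσ x hx).symm] at h
      exact hx h
  have hv' : σ⁻¹ v = v := Perm.inv_eq_iff_eq.mpr (hσ v hv).symm
  rw [star, Finset.mul_sum, Finset.sum_mul]
  refine (Finset.sum_nbij' (fun k => σ⁻¹ k) (fun k => σ k) ?_ ?_ ?_ ?_ ?_).symm
  · exact fun k hk => (hS k).mpr hk
  · exact fun k hk => (hS _).mp (by simpa using hk)
  · exact fun k _ => by simp
  · exact fun k _ => by simp
  · intro k _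
    rw [bracket_mul_bracket_comm]
    have h := swap_apply_apply σ⁻¹ k v
    rw [hv', inv_inv] at h
    rw [h]

theorem matching_mul_star {v : Fin d} {S : Finset (Fin d)} (hv : v ∉ S) :
    matching S * star v S = star v S * matching S := by
  rw [matching, Finset.sum_mul, Finset.mul_sum]
  exact Finset.sum_congr rfl fun σ hσ => bracket_mul_star hv (mem_involutions.mp hσ).2

theorem matching_mul_eval_star {v : Fin d} {S : Finset (Fin d)} (hv : v ∉ S)
    (p : PowerSeries ℚ) :
    matching S * eval (star v S) p = eval (star v S) p * matching S := by
  rw [eval_eq_sum, Finset.sum_mul, Finset.mul_sum]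
  refine Finset.sum_congr rfl fun n _ => ?_
  have h : Commute (matching S) (star v S) := matching_mul_star hv
  rw [smul_mul_assoc, mul_smul_comm, (h.pow_right n).eq]

/-- The power sums of the Jucys–Murphy elements with index in `S`. -/
noncomputable def powerSum (S : Finset (Fin d)) (n : ℕ) : Gr d :=
  ∑ v ∈ S, star v {k ∈ S | k < v} ^ n

theorem powerSum_insert {v : Fin d} {S : Finset (Fin d)} (h : ∀ x ∈ S, x < v) (n : ℕ) :
    powerSum (insert v S) n = star v S ^ n + powerSum S n := by
  have hv : v ∉ S := fun hv => lt_irrefl v (h v hv)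
  rw [powerSum, Finset.sum_insert hv, Finset.filter_insert, if_neg (lt_irrefl v),
    Finset.filter_true_of_mem h]
  congr 1
  refine Finset.sum_congr rfl fun x hx => ?_
  rw [Finset.filter_insert, if_neg (h x hx).not_gt]

/-- Logarithmic differentiation of the product of the f(J_v), points being added in increasing
order. `Gr d` is not commutative, so the new factor g(J_v) has to be moved past the matching sum by
`matching_mul_eval_star`. -/
theorem euler_matching {f h g : PowerSeries ℚ} (hf : f = 1 + PowerSeries.X * h)
    (hfh : f * h = 1) (hg : PowerSeries.X * PowerSeries.derivative ℚ f = f * g)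
    (S : Finset (Fin d)) :
    euler (matching S) =
      matching S * ∑ n ∈ Finset.range (d + 1), PowerSeries.coeff n g • powerSum S n := by
  induction S using Finset.induction_on_max with
  | empty =>
    have h1 : (matching ∅ : Gr d) = 1 := by
      have : involutions (∅ : Finset (Fin d)) = {1} := by
        ext σ
        rw [mem_involutions, Finset.mem_singleton]
        constructor
        · exact fun h => Perm.ext fun x => h.2 x (Finset.notMem_empty x)
        · rintro rfl
          exact ⟨mul_one 1, fun _ _ => rfl⟩
      rw [matching, this, Finset.sum_singleton, bracket_one]
    rw [h1, euler_of_mem one_mem_homogeneous]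
    simp [powerSum]
  | insert v S hlt ih =>
    have hv : v ∉ S := fun hv => lt_irrefl v (hlt v hv)
    have h1 : ∑ n ∈ Finset.range (d + 1), PowerSeries.coeff n g • powerSum (insert v S) n =
        eval (star v S) g +
          ∑ n ∈ Finset.range (d + 1), PowerSeries.coeff n g • powerSum S n := by
      simp only [powerSum_insert hlt, smul_add, Finset.sum_add_distrib, eval_eq_sum]
    rw [h1, matching_insert_eq_eval_mul hf hfh hv, euler_mul, ih,
      euler_eval (star_mem_homogeneous hv), hg, eval_mul (star_pow_eq_zero hv), mul_add,
      mul_assoc, mul_assoc, mul_assoc, matching_mul_eval_star hv]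

end Gr

/-! ### The series f = (1 + √(1 + 4X)) / 2 and its logarithmic derivative -/

open PowerSeries in
theorem exists_matching_series : ∃ f h g : PowerSeries ℚ, f = 1 + X * h ∧ f * h = 1 ∧
    X * derivative ℚ f = f * g ∧ ∀ n, 1 ≤ n → coeff n g ≠ 0 := by
  obtain ⟨h, hh⟩ : ∃ h : PowerSeries ℚ, h = 1 - X * h ^ 2 := by
    -- The solution is h(X) = c(−X), with c the Catalan series.
    let c : PowerSeries ℚ := map (Nat.castRingHom ℚ) catalanSeries
    have hc : c ^ 2 * X + 1 = c := by
      have := congrArg (map (Nat.castRingHom ℚ)) catalanSeries_sq_mul_X_add_one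
      simpa [c] using this
    refine ⟨evalNegHom c, ?_⟩
    have h1 := congrArg (evalNegHom (A := ℚ)) hc
    rw [map_add, map_mul, map_pow, map_one, evalNegHom_X] at h1
    linear_combination -h1
  obtain ⟨f, hf⟩ : ∃ f : PowerSeries ℚ, f = 1 + X * h := ⟨_, rfl⟩
  have hfh : f * h = 1 := by
    rw [hf]
    linear_combination hh
  have hff : f * f = f + X := by
    linear_combination f * hf + X * hfh
  have hW0 : constantCoeff (2 * f - 1) ≠ 0 := by
    have h2 : (2 : PowerSeries ℚ) * f - 1 = f + f - 1 := by ring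
    rw [h2, hf]
    simp
  -- S is (1 + 4X)^(−1/2), because (2f − 1)² = 1 + 4X. Its differential equation gives a two-term
  -- recursion that keeps the coefficients nonzero.
  obtain ⟨S, hS⟩ : ∃ S : PowerSeries ℚ, S * (2 * f - 1) = 1 :=
    ⟨(2 * f - 1)⁻¹, PowerSeries.inv_mul_cancel _ hW0⟩
  have hS0 : coeff 0 S ≠ 0 := by
    intro h0
    have := congrArg (coeff 0) hS
    rw [coeff_zero_eq_constantCoeff_apply] at h0
    simp [h0] at this
  have hf' : derivative ℚ f = S := by
    have h1 := congrArg (derivative ℚ) hff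
    rw [Derivation.leibniz, map_add, derivative_X, smul_eq_mul] at h1
    linear_combination S * h1 - derivative ℚ f * hS
  have hS' : derivative ℚ S * (1 + 4 * X) = -2 * S := by
    have h1 := congrArg (derivative ℚ) hS
    have h2 : (2 : PowerSeries ℚ) * f - 1 = f + f - 1 := by ring
    rw [Derivation.leibniz, h2, map_sub, map_add, hf', Derivation.map_one_eq_zero, smul_eq_mul,
      smul_eq_mul] at h1
    linear_combination (2 * f - 1) * h1 - 4 * derivative ℚ S * hff - 2 * S * hS
  have hrec : ∀ n : ℕ, coeff (n + 1) S * (n + 1) = -(4 * n + 2) * coeff n S := by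
    intro n
    have h1 : derivative ℚ S + C 4 * (X * derivative ℚ S) = C (-2) * S := by
      have h2 : (C 4 : PowerSeries ℚ) = 4 := map_ofNat _ _
      have h3 : (C (-2) : PowerSeries ℚ) = -2 := by rw [map_neg]; congr 1
      rw [h2, h3]
      linear_combination hS'
    have h2 := congrArg (coeff n) h1
    rw [map_add, coeff_C_mul, coeff_C_mul, coeff_derivative] at h2
    cases n with
    | zero =>
      rw [coeff_zero_X_mul] at h2
      push_cast at h2 ⊢
      linear_combination h2
    | succ n =>
      rw [coeff_succ_X_mul, coeff_derivative] at h2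
      push_cast at h2 ⊢
      linear_combination h2
  have hne : ∀ n, coeff n S ≠ 0 := by
    intro n
    induction n with
    | zero => exact hS0
    | succ n ih =>
      intro h0
      have h1 := hrec n
      rw [h0, zero_mul] at h1
      have h2 : (4 * (n : ℚ) + 2) ≠ 0 := by positivity
      exact mul_ne_zero (neg_ne_zero.mpr h2) ih h1.symm
  -- From S (2f − 1) = 1 and f² = f + X one gets f (1 − S)/2 = S (f² − f) = X S = X f'.
  refine ⟨f, h, C (1 / 2) * (1 - S), hf, hfh, ?_, fun n hn => ?_⟩
  · have h1 : (C (1 / 2) : PowerSeries ℚ) * 2 = 1 := by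
      rw [← map_ofNat (C (R := ℚ)) 2, ← map_mul]
      norm_num
    rw [hf']
    linear_combination (-S) * hff + f * C (1 / 2) * hS - S * (f * f - f) * h1
  · rw [coeff_C_mul, map_sub, coeff_one, if_neg (by omega), zero_sub]
    exact mul_ne_zero (by norm_num) (neg_ne_zero.mpr (hne n))

/-! ### Newton identities between the δ_i and the power sums -/

namespace Gr

variable {d : ℕ}

theorem sum_bracket_apply (s : Finset (Perm (Fin d))) (ρ : Perm (Fin d)) :
    (∑ σ ∈ s, bracket σ : Gr d) ρ = if ρ ∈ s then 1 else 0 := by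
  rw [sum_apply]
  simp only [bracket_apply]
  rw [Finset.sum_ite_eq]

theorem delta_apply (i : ℕ) (ρ : Perm (Fin d)) :
    (delta d i : Gr d) ρ = if ρ.cycleType = Multiset.replicate i 2 then 1 else 0 := by
  change (∑ σ : Perm (Fin d) with σ.cycleType = Multiset.replicate i 2, bracket σ : Gr d) ρ = _
  rw [sum_bracket_apply]
  simp

theorem norm_of_cycleType_eq_replicate {σ : Perm (Fin d)} {i : ℕ}
    (h : σ.cycleType = Multiset.replicate i 2) : norm σ = i := by
  have h1 := norm_add_card_cycleType σ
  rw [← Perm.sum_cycleType, h, Multiset.card_replicate, Multiset.sum_replicate, smul_eq_mul] at h1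
  omega

theorem delta_mem_homogeneous (i : ℕ) : (delta d i : Gr d) ∈ homogeneous d i := by
  intro σ hσ
  rw [delta_apply, if_neg]
  exact fun h => hσ (norm_of_cycleType_eq_replicate h)

theorem component_matching (i : ℕ) :
    component i (matching (Finset.univ : Finset (Fin d))) = delta d i := by
  ext σ
  rw [component_apply, delta_apply, matching, sum_bracket_apply, ← ite_and]
  refine if_congr ?_ rfl rfl
  rw [mem_involutions]
  constructor
  · rintro ⟨h1, h2, -⟩
    have h3 := Perm.cycleType_of_pow_prime_eq_one (p := 2) (by rw [pow_two, h2])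
    have h4 := norm_of_cycleType_eq_replicate h3
    rwa [← h4, h1] at h3
  · intro h
    refine ⟨norm_of_cycleType_eq_replicate h, ?_, fun x hx => absurd (Finset.mem_univ x) hx⟩
    have h1 : orderOf σ ∣ 2 := by
      rw [← Perm.lcm_cycleType, h, Multiset.lcm_dvd]
      intro b hb
      rw [Multiset.eq_of_mem_replicate hb]
    rw [← pow_two]
    exact orderOf_dvd_iff_pow_eq_one.mp h1

theorem delta_zero : (delta d 0 : Gr d) = 1 := by
  ext σ
  rw [delta_apply, one_apply]
  simp [Perm.cycleType_eq_zero]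

theorem delta_eq_zero {i : ℕ} (h : d / 2 < i) : (delta d i : Gr d) = 0 := by
  ext σ
  rw [delta_apply, zero_apply, if_neg]
  intro hσ
  have h1 := Perm.sum_cycleType_le σ
  rw [hσ, Multiset.sum_replicate, smul_eq_mul, Fintype.card_fin] at h1
  omega

theorem powerSum_mem_homogeneous (S : Finset (Fin d)) (n : ℕ) :
    powerSum S n ∈ homogeneous d n :=
  Submodule.sum_mem _ fun v _ => star_pow_mem_homogeneous (by simp) n

/-- This is the norm i component of `euler_matching` for the full set of points. -/
theorem exists_newton_identity : ∃ g : ℕ → ℚ, (∀ n, 1 ≤ n → g n ≠ 0) ∧ ∀ i : ℕ,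
    (i : ℚ) • (delta d i : Gr d) = ∑ p ∈ Finset.HasAntidiagonal.antidiagonal i,
      g p.2 • ((delta d p.1 : Gr d) * powerSum Finset.univ p.2) := by
  obtain ⟨f, h, g, hf, hfh, hg, hne⟩ := exists_matching_series
  refine ⟨fun n => PowerSeries.coeff n g, hne, fun i => ?_⟩
  have h1 := congrArg (component i) (euler_matching (d := d) hf hfh hg Finset.univ)
  rw [component_euler, component_mul, component_matching] at h1
  rw [h1]
  refine Finset.sum_congr rfl fun p hp => ?_
  rw [component_matching, ← mul_smul_comm, map_sum]
  congr 1
  simp only [map_smul, component_of_mem (powerSum_mem_homogeneous _ _), smul_ite, smul_zero]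
  rw [Finset.sum_ite_eq']
  split_ifs with h2
  · rfl
  · have h3 : d < p.2 := by simpa using h2
    rw [eq_zero_of_mem_homogeneous h3 (powerSum_mem_homogeneous _ _), smul_zero]

/-- Membership is stated inside `Gr d` because the power sums are elements of it whose conjugation
invariance is never proved directly: it follows from lying in this range. -/
theorem delta_mem_range (i : ℕ) : (delta d i : Gr d) ∈ ((A d).val.comp (presentation d)).range := by
  rcases Nat.eq_zero_or_pos i with rfl | h0
  · rw [delta_zero]
    exact one_mem _
  by_cases h : i ≤ d / 2
  · refine ⟨MvPolynomial.X ⟨i - 1, by omega⟩, ?_⟩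
    change ((MvPolynomial.aeval fun k : Fin (d / 2) => delta d (k + 1))
      (MvPolynomial.X ⟨i - 1, by omega⟩) : A d).1 = _
    rw [MvPolynomial.aeval_X]
    simp only [Nat.sub_add_cancel h0]
  · rw [delta_eq_zero (by omega)]
    exact zero_mem _

/-- Solve the Newton identity for its term with δ_0 = 1, whose coefficient `g n` is invertible; the
other terms involve smaller power sums. -/
theorem powerSum_mem_range {n : ℕ} (hn : 1 ≤ n) :
    (powerSum Finset.univ n : Gr d) ∈ ((A d).val.comp (presentation d)).range := by
  obtain ⟨g, hg, hnewton⟩ := exists_newton_identity (d := d)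
  -- The zeroth power sum need not be treated: the Newton identity in norm 0 shows that it enters
  -- with weight zero.
  have h00 : g 0 • (powerSum Finset.univ 0 : Gr d) = 0 := by
    simpa [delta_zero] using (hnewton 0).symm
  induction n using Nat.strong_induction_on with
  | _ n ih =>
    have h1 := hnewton n
    have hmem : ((0, n) : ℕ × ℕ) ∈ Finset.HasAntidiagonal.antidiagonal n := by simp
    rw [← Finset.add_sum_erase _ _ hmem, delta_zero, one_mul] at h1
    have h2 : (powerSum Finset.univ n : Gr d) = (g n)⁻¹ • ((n : ℚ) • (delta d n : Gr d) -
        ∑ p ∈ (Finset.HasAntidiagonal.antidiagonal n).erase (0, n),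
          g p.2 • ((delta d p.1 : Gr d) * powerSum Finset.univ p.2)) := by
      rw [h1, add_sub_cancel_right, smul_smul, inv_mul_cancel₀ (hg n hn), one_smul]
    rw [h2]
    refine Subalgebra.smul_mem _ (sub_mem (Subalgebra.smul_mem _ (delta_mem_range n) _)
      (sum_mem fun p hp => ?_)) _
    obtain ⟨hp1, hp2⟩ := Finset.mem_erase.mp hp
    rw [Finset.HasAntidiagonal.mem_antidiagonal] at hp2
    have hp3 : p.1 ≠ 0 := fun h => hp1 (Prod.ext h (by omega))
    rcases Nat.eq_zero_or_pos p.2 with hp4 | hp4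
    · rw [hp4, ← mul_smul_comm, h00, mul_zero]
      exact zero_mem _
    · exact Subalgebra.smul_mem _ (mul_mem (delta_mem_range _) (ih p.2 (by omega) hp4)) _

/-! ### Power sums are positive combinations of cycles -/

theorem bracket_nonneg (σ ρ : Perm (Fin d)) : 0 ≤ bracket σ ρ := by
  rw [bracket_apply]
  split_ifs <;> norm_num

theorem star_nonneg (v : Fin d) (S : Finset (Fin d)) (σ : Perm (Fin d)) : 0 ≤ star v S σ := by
  rw [star, sum_apply]
  exact Finset.sum_nonneg fun k _ => bracket_nonneg _ _

theorem star_pow_nonneg (v : Fin d) (S : Finset (Fin d)) (n : ℕ) (σ : Perm (Fin d)) :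
    0 ≤ (star v S ^ n) σ :=
  pow_nonneg (star_nonneg v S) n σ

theorem powerSum_nonneg (S : Finset (Fin d)) (n : ℕ) (σ : Perm (Fin d)) : 0 ≤ powerSum S n σ := by
  rw [powerSum, sum_apply]
  exact Finset.sum_nonneg fun v _ => star_pow_nonneg _ _ n σ

theorem exists_support_subset_of_star_pow_apply_ne_zero {v : Fin d} {S : Finset (Fin d)} {n : ℕ}
    {σ : Perm (Fin d)} (h : (star v S ^ n) σ ≠ 0) :
    ∃ U : Finset (Fin d), v ∈ U ∧ U.card ≤ n + 1 ∧ σ.support ⊆ U := by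
  induction n generalizing σ with
  | zero =>
    rw [pow_zero, one_apply] at h
    have h1 : σ = 1 := by
      by_contra hσ
      exact h (if_neg hσ)
    exact ⟨{v}, by simp, by simp, by simp [h1]⟩
  | succ n ih =>
    rw [pow_succ] at h
    obtain ⟨α, β, rfl, -, hα, hβ⟩ := exists_of_mul_apply_ne_zero h
    obtain ⟨U, hv, hU, hαU⟩ := ih hα
    rw [star, sum_apply] at hβ
    obtain ⟨k, -, hk⟩ := Finset.exists_ne_zero_of_sum_ne_zero hβ
    have hβk : β = swap k v := by
      by_contra hne
      exact hk (if_neg hne)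
    refine ⟨insert k U, Finset.mem_insert_of_mem hv,
      (Finset.card_insert_le _ _).trans (by omega), fun x hx => ?_⟩
    rcases Finset.mem_union.mp (Perm.support_mul_le α β hx) with hx | hx
    · exact Finset.mem_insert_of_mem (hαU hx)
    · rw [hβk, Perm.mem_support] at hx
      by_contra hxU
      rw [Finset.mem_insert, not_or] at hxU
      exact hx (swap_apply_of_ne_of_ne hxU.1 fun h => hxU.2 (h ▸ hv))

/-- Such a σ has norm n and moves at most n + 1 points, which leaves room for only one cycle. -/
theorem cycleType_of_powerSum_apply_ne_zero {n : ℕ} (hn : 1 ≤ n) {σ : Perm (Fin d)}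
    (h : (powerSum Finset.univ n) σ ≠ 0) : σ.cycleType = {n + 1} := by
  have hnorm : norm σ = n := not_not.mp fun h' => h (powerSum_mem_homogeneous _ _ _ h')
  rw [powerSum, sum_apply] at h
  obtain ⟨v, -, hv⟩ := Finset.exists_ne_zero_of_sum_ne_zero h
  obtain ⟨U, -, hU, hσ⟩ := exists_support_subset_of_star_pow_apply_ne_zero hv
  have h1 := norm_add_card_cycleType σ
  have h2 := Finset.card_le_card hσ
  have h3 : 0 < σ.cycleType.card := Perm.card_cycleType_pos.mpr fun h' => by
    rw [h', norm_one] at hnorm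
    omega
  have h4 : σ.cycleType.card = 1 := by omega
  rw [(Perm.card_cycleType_eq_one.mp h4).cycleType]
  congr 1
  omega

theorem star_pow_apply_pos {v : Fin d} {S : Finset (Fin d)} (n : ℕ)
    {σ : Perm (Fin d)} (hσ : σ.IsCycle) (hn : norm σ = n + 1) (hv : v ∈ σ.support)
    (hS : σ.support ⊆ insert v S) : 0 < (star v S ^ (n + 1)) σ := by
  have hstar : ∀ k, k ∈ σ.support → k ≠ v → 0 < star v S (swap k v) := by
    intro k hk hkv
    rw [star, sum_apply]
    refine Finset.sum_pos' (fun l _ => bracket_nonneg _ _) ⟨k, ?_, ?_⟩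
    · exact Finset.mem_of_mem_insert_of_ne (hS hk) hkv
    · rw [bracket_apply, if_pos rfl]
      exact one_pos
  have hcard : ∀ τ : Perm (Fin d), τ.IsCycle → τ.support.card = norm τ + 1 := fun τ hτ => by
    rw [← norm_add_card_cycleType, Perm.card_cycleType_eq_one.mpr hτ]
  induction n generalizing σ with
  | zero =>
    have h1 := hcard σ hσ
    rw [hn] at h1
    obtain ⟨x, y, hxy, rfl⟩ := Perm.card_support_eq_two.mp h1
    rw [zero_add, pow_one]
    rw [Perm.support_swap hxy] at hv hstar
    rcases Finset.mem_insert.mp hv with rfl | hv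
    · rw [swap_comm]
      exact hstar y (by simp) hxy.symm
    · rw [Finset.mem_singleton] at hv
      subst hv
      exact hstar x (by simp) hxy
  | succ n ih =>
    -- Multiplying on the left by (k v), where σ k = v, makes k fixed and leaves a cycle through v
    -- of norm one less, to which induction applies.
    obtain ⟨k, hk⟩ : ∃ k, σ k = v := σ.surjective v
    have hσv : σ v ≠ v := Perm.mem_support.mp hv
    have hkv : k ≠ v := fun h => hσv (h ▸ hk)
    have hσk : σ k ≠ k := hk ▸ hkv.symm
    have hks : k ∈ σ.support := Perm.mem_support.mpr hσk
    have h3 := hcard σ hσ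
    have hσσ : σ (σ k) ≠ k := by
      intro h
      have h1 := hσ.eq_swap_of_apply_apply_eq_self hσk h
      rw [h1, norm_swap hσk.symm] at hn
      omega
    have hτ := hσ.swap_mul hσk hσσ
    have hsupp := Perm.support_swap_mul_eq σ k hσσ
    rw [hk] at hτ hsupp
    have hτcard := hcard _ hτ
    have hvτ : v ∈ (swap k v * σ).support := by
      rw [hsupp, Finset.mem_sdiff, Finset.mem_singleton]
      exact ⟨hv, hkv.symm⟩
    have hsub : (swap k v * σ).support ⊆ σ.support := hsupp ▸ Finset.sdiff_subset
    have hτn : norm (swap k v * σ) = n + 1 := by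
      rw [hsupp, Finset.card_sdiff_of_subset (by simpa using hσk), Finset.card_singleton] at hτcard
      omega
    have hpos := ih hτ hτn hvτ (hsub.trans hS) fun l hl hlv => hstar l (hsub hl) hlv
    have h1 := mul_pos (star_nonneg v S) (star_pow_nonneg v S (n + 1)) (σ := swap k v)
      (τ := swap k v * σ) (by rw [swap_mul_self_mul, hn, hτn, norm_swap hkv]; omega)
      (hstar k hks hkv) hpos
    rwa [swap_mul_self_mul, ← pow_succ'] at h1

theorem powerSum_apply_pos {σ : Perm (Fin d)} (hσ : σ.IsCycle) :
    0 < powerSum Finset.univ (norm σ) σ := by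
  obtain ⟨n, hn⟩ : ∃ n, norm σ = n + 1 :=
    Nat.exists_eq_succ_of_ne_zero fun h => hσ.ne_one (norm_eq_zero_iff.mp h)
  have hne : σ.support.Nonempty := by
    obtain ⟨x, hx, -⟩ := hσ
    exact ⟨x, Perm.mem_support.mpr hx⟩
  rw [powerSum, sum_apply]
  -- Taking v to be the largest moved point puts the other moved points among those summed over in
  -- J_v.
  refine Finset.sum_pos' (fun v _ => star_pow_nonneg _ _ _ _)
    ⟨σ.support.max' hne, Finset.mem_univ _, ?_⟩
  rw [hn]
  refine star_pow_apply_pos n hσ hn (Finset.max'_mem _ hne) fun x hx => ?_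
  rcases (Finset.le_max' _ x hx).eq_or_lt with h | h
  · rw [← h]
    exact Finset.mem_insert_self _ _
  · exact Finset.mem_insert_of_mem (by simpa using h)

/-! ### Class sums and surjectivity -/

theorem mem_A_iff {f : Gr d} :
    f ∈ A d ↔ ∀ σ τ : Perm (Fin d), σ.cycleType = τ.cycleType → f σ = f τ := by
  constructor
  · intro hf σ τ h
    obtain ⟨π, rfl⟩ := isConj_iff.mp (Perm.isConj_iff_cycleType_eq.mpr h)
    exact (hf σ π).symm
  · exact fun hf σ τ => hf _ _ Perm.cycleType_conj

/-- The sum of the permutations with a given cycle type. -/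
noncomputable def classSum (d : ℕ) (μ : Multiset ℕ) : Gr d :=
  fun σ => if σ.cycleType = μ then 1 else 0

theorem classSum_apply (μ : Multiset ℕ) (σ : Perm (Fin d)) :
    classSum d μ σ = if σ.cycleType = μ then 1 else 0 := rfl

theorem classSum_mem (μ : Multiset ℕ) : classSum d μ ∈ A d :=
  mem_A_iff.mpr fun σ τ h => by rw [classSum_apply, classSum_apply, h]

/-- Summing over permutations instead of classes counts each class as often as it has elements,
hence the division by its size. -/
theorem mem_of_forall_classSum_mem {B : Submodule ℚ (Gr d)} {f : Gr d} (hf : f ∈ A d)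
    (hB : ∀ σ, f σ ≠ 0 → classSum d σ.cycleType ∈ B) : f ∈ B := by
  have h : f = ∑ σ : Perm (Fin d),
      (f σ / (Finset.univ.filter fun ρ : Perm (Fin d) => ρ.cycleType = σ.cycleType).card) •
        classSum d σ.cycleType := by
    ext ρ
    rw [sum_apply]
    simp only [smul_apply, classSum_apply, mul_ite, mul_one, mul_zero]
    rw [← Finset.sum_filter]
    have h1 : ∀ σ ∈ Finset.univ.filter fun σ : Perm (Fin d) => ρ.cycleType = σ.cycleType,
        f σ / (Finset.univ.filter fun π : Perm (Fin d) => π.cycleType = σ.cycleType).card =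
          f ρ / (Finset.univ.filter fun π : Perm (Fin d) => ρ.cycleType = π.cycleType).card := by
      intro σ hσ
      have h2 := (Finset.mem_filter.mp hσ).2
      rw [mem_A_iff.mp hf σ ρ h2.symm, ← h2]
      simp only [eq_comm]
    rw [Finset.sum_congr rfl h1, Finset.sum_const, nsmul_eq_mul, mul_div_cancel₀]
    rw [Nat.cast_ne_zero]
    exact (Finset.card_pos.mpr ⟨ρ, by simp⟩).ne'
  rw [h]
  refine Submodule.sum_mem _ fun σ _ => ?_
  by_cases hσ : f σ = 0
  · rw [hσ, zero_div, zero_smul]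
    exact zero_mem _
  · exact Submodule.smul_mem _ _ (hB σ hσ)

theorem range_le_A : ((A d).val.comp (presentation d)).range ≤ A d := by
  rintro _ ⟨p, rfl⟩
  exact (presentation d p).2

theorem classSum_mem_range (σ : Perm (Fin d)) :
    classSum d σ.cycleType ∈ ((A d).val.comp (presentation d)).range := by
  induction hr : σ.cycleType.card using Nat.strong_induction_on generalizing σ with
  | _ r ih =>
    subst hr
    by_cases hσ : σ = 1
    · have h1 : classSum d σ.cycleType = 1 := by
        ext ρ
        rw [classSum_apply, one_apply, hσ]
        simp
      rw [h1]
      exact one_mem _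
    obtain ⟨c, hc⟩ : σ.cycleFactorsFinset.Nonempty := by
      rwa [Finset.nonempty_iff_ne_empty, Ne, Perm.cycleFactorsFinset_eq_empty_iff]
    have hcyc := (Perm.mem_cycleFactorsFinset_iff.mp hc).1
    obtain ⟨τ, hτσ, hd⟩ : ∃ τ, c * τ = σ ∧ c.Disjoint τ := by
      have h1 := Perm.disjoint_mul_inv_of_mem_cycleFactorsFinset hc
      refine ⟨σ * c⁻¹, ?_, h1.symm⟩
      rw [h1.symm.commute.eq, inv_mul_cancel_right]
    have hn : 1 ≤ norm c :=
      Nat.one_le_iff_ne_zero.mpr fun h => hcyc.ne_one (norm_eq_zero_iff.mp h)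
    have hct : c.cycleType = {norm c + 1} := by
      rw [hcyc.cycleType, ← norm_add_card_cycleType, Perm.card_cycleType_eq_one.mpr hcyc]
    have hστ : σ.cycleType = c.cycleType + τ.cycleType := by rw [← hτσ, hd.cycleType_mul]
    have hcard : σ.cycleType.card = τ.cycleType.card + 1 := by
      rw [hστ, hct, Multiset.card_add, Multiset.card_singleton, add_comm]
    obtain ⟨p, hp⟩ : ∃ p : Gr d, p = powerSum Finset.univ (norm c) * classSum d τ.cycleType :=
      ⟨_, rfl⟩
    have hpB : p ∈ ((A d).val.comp (presentation d)).range := by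
      rw [hp]
      exact mul_mem (powerSum_mem_range hn) (ih _ (by omega) τ rfl)
    have hpos : 0 < p σ := by
      rw [hp, ← hτσ]
      refine mul_pos (powerSum_nonneg _ _) (fun ρ => ?_) (norm_mul_of_disjoint hd)
        (powerSum_apply_pos hcyc) ?_
      · rw [classSum_apply]
        split_ifs <;> norm_num
      · rw [classSum_apply, if_pos rfl]
        exact one_pos
    -- If α β has at least as many cycles as σ, additivity of the norm forces its support to have at
    -- least |supp α| + |supp β| points. The supports are then disjoint, and the cycle type is that
    -- of σ.
    have hlow : ∀ ρ, p ρ ≠ 0 → ρ.cycleType ≠ σ.cycleType →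
        ρ.cycleType.card < σ.cycleType.card := by
      intro ρ hρ hne
      by_contra hge
      rw [hp] at hρ
      obtain ⟨α, β, rfl, hnorm, hα, hβ⟩ := exists_of_mul_apply_ne_zero hρ
      have hαc := cycleType_of_powerSum_apply_ne_zero hn hα
      have hβc : β.cycleType = τ.cycleType := by
        by_contra h
        exact hβ (if_neg h)
      have h1 := norm_add_card_cycleType α
      have h2 := norm_add_card_cycleType β
      have h3 := norm_add_card_cycleType (α * β)
      have h4 := Finset.card_le_card (Perm.support_mul_le α β)
      have h5 := Finset.card_union_add_card_inter α.support β.support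
      rw [hαc, Multiset.card_singleton] at h1
      rw [hβc] at h2
      rw [Finset.sup_eq_union] at h4
      have h6 : (α.support ∩ β.support).card = 0 := by omega
      have h7 : α.Disjoint β := by
        rw [Perm.disjoint_iff_disjoint_support, Finset.disjoint_iff_inter_eq_empty]
        exact Finset.card_eq_zero.mp h6
      exact hne (by rw [h7.cycleType_mul, hαc, hβc, hστ, hct])
    have hrest : p - p σ • classSum d σ.cycleType ∈
        Subalgebra.toSubmodule ((A d).val.comp (presentation d)).range := by
      refine mem_of_forall_classSum_mem
        (sub_mem (range_le_A hpB) (Subalgebra.smul_mem _ (classSum_mem _) _)) fun ρ hρ => ?_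
      rw [sub_apply, smul_apply, classSum_apply] at hρ
      have hne : ρ.cycleType ≠ σ.cycleType := by
        intro h
        rw [if_pos h, mul_one, mem_A_iff.mp (range_le_A hpB) ρ σ h, sub_self] at hρ
        exact hρ rfl
      rw [if_neg hne, mul_zero, sub_zero] at hρ
      exact ih _ (hlow ρ hρ hne) ρ rfl
    have h1 : classSum d σ.cycleType =
        (p σ)⁻¹ • (p - (p - p σ • classSum d σ.cycleType)) := by
      rw [sub_sub_cancel, smul_smul, inv_mul_cancel₀ hpos.ne', one_smul]
    rw [h1]
    exact Subalgebra.smul_mem _ (sub_mem hpB hrest) _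

end Gr

theorem presentation_surjective (d : ℕ) : Function.Surjective (presentation d) := by
  intro f
  have h : (f : Gr d) ∈ Subalgebra.toSubmodule ((A d).val.comp (presentation d)).range :=
    Gr.mem_of_forall_classSum_mem f.2 fun σ _ => Gr.classSum_mem_range σ
  obtain ⟨p, hp⟩ := h
  exact ⟨p, Subtype.ext hp⟩

/-! ### Counting partitions with very many parts or a very large part -/

theorem card_le_sum_of_pos {s : Multiset ℕ} (hs : ∀ x ∈ s, 0 < x) : s.card ≤ s.sum := by
  simpa using Multiset.card_nsmul_le_sum (a := 1) hs

/-- A part a contributes a − 1 to sum minus length, so an excess of at most 2 comes from no large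
part, one 2, one 3, or two 2s. -/
theorem exists_eq_cons_replicate_of_sum_le {s : Multiset ℕ} (hs : ∀ x ∈ s, 0 < x)
    (h : s.sum ≤ s.card + 2) : ∃ k, s = Multiset.replicate k 1 ∨
      s = 2 ::ₘ Multiset.replicate k 1 ∨ s = 3 ::ₘ Multiset.replicate k 1 ∨
        s = 2 ::ₘ 2 ::ₘ Multiset.replicate k 1 := by
  induction s using Multiset.induction_on with
  | empty => exact ⟨0, by simp⟩
  | cons a s ih =>
    have ha : 0 < a := hs a (Multiset.mem_cons_self a s)
    have hs' : ∀ x ∈ s, 0 < x := fun x hx => hs x (Multiset.mem_cons_of_mem hx)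
    have hc := card_le_sum_of_pos hs'
    rw [Multiset.sum_cons, Multiset.card_cons] at h
    obtain ⟨k, rfl | rfl | rfl | rfl⟩ := ih hs' (by omega)
    · simp only [Multiset.sum_replicate, Multiset.card_replicate, smul_eq_mul] at h
      obtain rfl | rfl | rfl : a = 1 ∨ a = 2 ∨ a = 3 := by omega
      · exact ⟨k + 1, by simp [Multiset.replicate_succ]⟩
      · exact ⟨k, by simp⟩
      · exact ⟨k, by simp⟩
    · simp only [Multiset.sum_cons, Multiset.card_cons, Multiset.sum_replicate,
        Multiset.card_replicate, smul_eq_mul] at h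
      obtain rfl | rfl : a = 1 ∨ a = 2 := by omega
      · exact ⟨k + 1, by rw [Multiset.cons_swap]; simp [Multiset.replicate_succ]⟩
      · exact ⟨k, by simp⟩
    · simp only [Multiset.sum_cons, Multiset.card_cons, Multiset.sum_replicate,
        Multiset.card_replicate, smul_eq_mul] at h
      obtain rfl : a = 1 := by omega
      exact ⟨k + 1, by rw [Multiset.cons_swap]; simp [Multiset.replicate_succ]⟩
    · simp only [Multiset.sum_cons, Multiset.card_cons, Multiset.sum_replicate,
        Multiset.card_replicate, smul_eq_mul] at h
      obtain rfl : a = 1 := by omega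
      refine ⟨k + 1, ?_⟩
      rw [Multiset.cons_swap, Multiset.cons_swap 1 2]
      simp [Multiset.replicate_succ]

theorem card_partition_filter_eq {n : ℕ} (P : Multiset ℕ → Prop) [DecidablePred P]
    (T : Finset (Multiset ℕ))
    (hT : ∀ s, s ∈ T ↔ (∀ x ∈ s, 0 < x) ∧ s.sum = n ∧ P s) :
    (Finset.univ.filter fun p : n.Partition => P p.parts).card = T.card := by
  rw [← Finset.card_image_of_injective (f := Nat.Partition.parts) _ fun _ _ => Nat.Partition.ext]
  congr 1
  ext s
  rw [hT, Finset.mem_image]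
  constructor
  · rintro ⟨p, hp, rfl⟩
    exact ⟨fun x hx => p.parts_pos hx, p.parts_sum, (Finset.mem_filter.mp hp).2⟩
  · rintro ⟨h1, h2, h3⟩
    exact ⟨⟨s, fun {i} hi => h1 i hi, h2⟩, by simpa using h3, rfl⟩

theorem card_partition_le_card_parts (n : ℕ) :
    (Finset.univ.filter fun p : n.Partition => n ≤ p.parts.card).card = 1 := by
  rw [card_partition_filter_eq (fun s => n ≤ s.card) {Multiset.replicate n 1},
    Finset.card_singleton]
  intro s
  rw [Finset.mem_singleton]
  constructor
  · rintro rfl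
    simp +contextual [Multiset.mem_replicate]
  · rintro ⟨h1, h2, h3⟩
    obtain ⟨k, rfl | rfl | rfl | rfl⟩ := exists_eq_cons_replicate_of_sum_le h1 (by omega) <;>
    simp only [Multiset.sum_cons, Multiset.card_cons, Multiset.sum_replicate,
      Multiset.card_replicate, smul_eq_mul] at h2 h3
    · rw [← h2, mul_one]
    all_goals omega

theorem card_partition_le_card_parts_add_one {n : ℕ} (hn : 2 ≤ n) :
    (Finset.univ.filter fun p : n.Partition => n ≤ p.parts.card + 1).card = 2 := by
  obtain ⟨n, rfl⟩ := Nat.exists_eq_add_of_le' hn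
  rw [card_partition_filter_eq (fun s => n + 2 ≤ s.card + 1)
    {Multiset.replicate (n + 2) 1, 2 ::ₘ Multiset.replicate n 1}, Finset.card_pair]
  · intro h
    have := congrArg (Multiset.count 2) h
    simp [Multiset.count_replicate] at this
  intro s
  rw [Finset.mem_insert, Finset.mem_singleton]
  constructor
  · rintro (rfl | rfl)
    · simp +contextual [Multiset.mem_replicate]
      omega
    · simp +contextual [Multiset.mem_replicate]
      omega
  · rintro ⟨h1, h2, h3⟩
    obtain ⟨k, rfl | rfl | rfl | rfl⟩ := exists_eq_cons_replicate_of_sum_le h1 (by omega) <;>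
    simp only [Multiset.sum_cons, Multiset.card_cons, Multiset.sum_replicate,
      Multiset.card_replicate, smul_eq_mul] at h2 h3
    · left
      congr 1
      omega
    · right
      congr 2
      omega
    all_goals omega

/-- The bound 4 ≤ n is what allows two parts equal to 2. With n = m + 2 it is the source of the
condition m ≥ 2 in the odd case. -/
theorem card_partition_le_card_parts_add_two {n : ℕ} (hn : 4 ≤ n) :
    (Finset.univ.filter fun p : n.Partition => n ≤ p.parts.card + 2).card = 4 := by
  obtain ⟨n, rfl⟩ := Nat.exists_eq_add_of_le' hn
  rw [card_partition_filter_eq (fun s => n + 4 ≤ s.card + 2)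
    {Multiset.replicate (n + 4) 1, 2 ::ₘ Multiset.replicate (n + 2) 1,
      3 ::ₘ Multiset.replicate (n + 1) 1, 2 ::ₘ 2 ::ₘ Multiset.replicate n 1}]
  · have h : ∀ s t : Multiset ℕ, (s.count 2 ≠ t.count 2 ∨ s.count 3 ≠ t.count 3) → s ≠ t := by
      rintro s t h rfl
      simp at h
    rw [Finset.card_insert_of_notMem, Finset.card_insert_of_notMem, Finset.card_pair]
    · apply h
      simp [Multiset.count_replicate]
    · simp only [Finset.mem_insert, Finset.mem_singleton, not_or]
      constructor <;> apply h <;> simp [Multiset.count_replicate]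
    · simp only [Finset.mem_insert, Finset.mem_singleton, not_or]
      refine ⟨?_, ?_, ?_⟩ <;> apply h <;> simp [Multiset.count_replicate]
  intro s
  simp only [Finset.mem_insert, Finset.mem_singleton]
  constructor
  · rintro (rfl | rfl | rfl | rfl)
    · simp +contextual [Multiset.mem_replicate]
      omega
    · simp +contextual [Multiset.mem_replicate]
      omega
    · simp +contextual [Multiset.mem_replicate]
      omega
    · simp +contextual [Multiset.mem_replicate]
      omega
  · rintro ⟨h1, h2, h3⟩
    obtain ⟨k, rfl | rfl | rfl | rfl⟩ := exists_eq_cons_replicate_of_sum_le h1 (by omega) <;>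
    simp only [Multiset.sum_cons, Multiset.card_cons, Multiset.sum_replicate,
      Multiset.card_replicate, smul_eq_mul] at h2 h3
    · left
      congr 1
      omega
    · right
      left
      congr 2
      omega
    · right
      right
      left
      congr 2
      omega
    · right
      right
      right
      congr 3
      omega

theorem card_partition_exists_part_ge {m : ℕ} :
    (Finset.univ.filter fun p : (m + 1).Partition => ¬∀ x ∈ p.parts, x ≤ m).card = 1 := by
  rw [card_partition_filter_eq (fun s => ¬∀ x ∈ s, x ≤ m) {{m + 1}}, Finset.card_singleton]
  intro s
  rw [Finset.mem_singleton]
  constructor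
  · rintro rfl
    simp
  · rintro ⟨h1, h2, h3⟩
    push Not at h3
    obtain ⟨x, hx, hxm⟩ := h3
    obtain ⟨t, rfl⟩ := Multiset.exists_cons_of_mem hx
    rw [Multiset.sum_cons] at h2
    have h4 := card_le_sum_of_pos fun y hy => h1 y (Multiset.mem_cons_of_mem hy)
    obtain rfl : t = 0 := Multiset.card_eq_zero.mp (by omega)
    obtain rfl : x = m + 1 := by simpa using h2
    rfl

theorem card_partition_add_two_exists_part_ge {m : ℕ} :
    (Finset.univ.filter fun p : (m + 2).Partition => ¬∀ x ∈ p.parts, x ≤ m).card = 2 := by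
  rw [card_partition_filter_eq (fun s => ¬∀ x ∈ s, x ≤ m) {{m + 2}, {m + 1, 1}},
    Finset.card_pair]
  · intro h
    have := congrArg Multiset.card h
    simp at this
  intro s
  rw [Finset.mem_insert, Finset.mem_singleton]
  constructor
  · rintro (rfl | rfl) <;> simp
  · rintro ⟨h1, h2, h3⟩
    push Not at h3
    obtain ⟨x, hx, hxm⟩ := h3
    obtain ⟨t, rfl⟩ := Multiset.exists_cons_of_mem hx
    rw [Multiset.sum_cons] at h2
    have h4 := card_le_sum_of_pos fun y hy => h1 y (Multiset.mem_cons_of_mem hy)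
    obtain h5 | h5 : t.card = 0 ∨ t.card = 1 := by omega
    · obtain rfl := Multiset.card_eq_zero.mp h5
      obtain rfl : x = m + 2 := by simpa using h2
      exact Or.inl rfl
    · obtain ⟨y, rfl⟩ := Multiset.card_eq_one.mp h5
      rw [Multiset.sum_singleton] at h2
      have h6 := h1 y (by simp)
      obtain ⟨rfl, rfl⟩ : x = m + 1 ∧ y = 1 := by omega
      exact Or.inr rfl

/-! ### Dimensions of the homogeneous parts -/

section Dimension

variable {d : ℕ}

theorem weight_ne_zero (k : Fin (d / 2)) : weight d k ≠ 0 := Nat.succ_ne_zero _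

theorem sum_map_add_one (s : Multiset ℕ) : (s.map (· + 1)).sum = s.sum + s.card := by
  rw [Multiset.sum_map_add]
  simp

theorem sum_map_weight (e : Fin (d / 2) →₀ ℕ) :
    ((Finsupp.toMultiset e).map (weight d)).sum = Finsupp.weight (weight d) e := by
  induction e using Finsupp.induction_linear with
  | zero => simp
  | add e f he hf => rw [map_add, Multiset.map_add, Multiset.sum_add, he, hf, map_add]
  | single k n =>
    rw [Finsupp.toMultiset_single, Multiset.map_nsmul, Multiset.map_singleton, Multiset.sum_nsmul,
      Multiset.sum_singleton, Finsupp.weight_single]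

theorem card_weight_eq (n : ℕ) :
    Nat.card {e : Fin (d / 2) →₀ ℕ | Finsupp.weight (weight d) e = n} =
      (Finset.univ.filter fun p : n.Partition => ∀ x ∈ p.parts, x ≤ d / 2).card := by
  have hmem : ∀ (e : Fin (d / 2) →₀ ℕ) (x : ℕ), x ∈ (Finsupp.toMultiset e).map (weight d) →
      0 < x ∧ x ≤ d / 2 := by
    intro e x hx
    obtain ⟨k, -, rfl⟩ := Multiset.mem_map.mp hx
    exact ⟨Nat.succ_pos _, k.2⟩
  have hinj : Function.Injective (weight d) := fun i j h => Fin.ext (Nat.succ_injective h)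
  rw [← Fintype.card_subtype, ← Nat.card_eq_fintype_card]
  refine Nat.card_eq_of_bijective (fun e => ⟨⟨(Finsupp.toMultiset e.1).map (weight d),
    fun {i} hi => (hmem _ _ hi).1, (sum_map_weight _).trans e.2⟩, fun x hx => (hmem _ _ hx).2⟩)
    ⟨fun e f h => ?_, fun ⟨p, hp⟩ => ?_⟩
  · have h1 := congrArg (fun p => p.1.parts) h
    have h2 := congrArg Multiset.toFinsupp (Multiset.map_injective hinj h1)
    rw [Finsupp.toMultiset_toFinsupp, Finsupp.toMultiset_toFinsupp] at h2
    exact Subtype.ext h2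
  · have hs : ∀ s : Multiset ℕ, (∀ x ∈ s, 0 < x ∧ x ≤ d / 2) →
        ∃ t : Multiset (Fin (d / 2)), t.map (weight d) = s := by
      intro s
      induction s using Multiset.induction_on with
      | empty => exact fun _ => ⟨0, rfl⟩
      | cons a s ih =>
        intro h
        obtain ⟨t, ht⟩ := ih fun x hx => h x (Multiset.mem_cons_of_mem hx)
        have ha := h a (Multiset.mem_cons_self a s)
        refine ⟨⟨a - 1, by omega⟩ ::ₘ t, ?_⟩
        rw [Multiset.map_cons, ht, weight, Nat.sub_add_cancel ha.1]
    obtain ⟨t, ht⟩ := hs p.parts fun x hx => ⟨p.parts_pos hx, hp x hx⟩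
    have ht' : (Finsupp.toMultiset (Multiset.toFinsupp t)).map (weight d) = p.parts := by
      rw [Multiset.toFinsupp_toMultiset, ht]
    refine ⟨⟨Multiset.toFinsupp t, ?_⟩, Subtype.ext (Nat.Partition.ext ht')⟩
    rw [Set.mem_ofPred_eq, ← sum_map_weight, ht', p.parts_sum]

theorem finrank_weightedHomogeneousSubmodule (n : ℕ) :
    Module.finrank ℚ (MvPolynomial.weightedHomogeneousSubmodule ℚ (weight d) n) =
      (Finset.univ.filter fun p : n.Partition => ∀ x ∈ p.parts, x ≤ d / 2).card := by
  have : Finite {e : Fin (d / 2) →₀ ℕ | Finsupp.weight (weight d) e = n} :=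
    (Finsupp.finite_of_nat_weight_eq (weight d) weight_ne_zero n).to_subtype
  have := Fintype.ofFinite {e : Fin (d / 2) →₀ ℕ | Finsupp.weight (weight d) e = n}
  rw [MvPolynomial.weightedHomogeneousSubmodule_eq_finsupp_supported, ← card_weight_eq,
    (AddMonoidAlgebra.supportedEquivFinsupp (R := ℚ) (S := ℚ) _).finrank_eq,
    Module.finrank_finsupp_self, Nat.card_eq_fintype_card]

instance (n : ℕ) :
    Module.Finite ℚ (MvPolynomial.weightedHomogeneousSubmodule ℚ (weight d) n) :=
  Module.Finite.iff_fg.mpr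
    (MvPolynomial.weightedHomogeneousSubmodule_fg (R := ℚ) (weight d) weight_ne_zero n)

/-- The elements of `A(d)` that are homogeneous of norm `n`. -/
noncomputable def homogeneousInvariants (d n : ℕ) : Submodule ℚ (Gr d) :=
  Gr.homogeneous d n ⊓ Subalgebra.toSubmodule (A d)

theorem map_pred_map_add_one {s : Multiset ℕ} (hs : ∀ x ∈ s, 0 < x) :
    (s.map (· - 1)).map (· + 1) = s := by
  rw [Multiset.map_map]
  conv_rhs => rw [← Multiset.map_id s]
  exact Multiset.map_congr rfl fun x hx => Nat.sub_add_cancel (hs x hx)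

/-- Lowering each cycle length by one gives parts whose sum is the norm; the norm plus the number of
parts is then the support size, at most d. -/
theorem exists_partition_of_norm_eq {n : ℕ} {σ : Perm (Fin d)} (h : norm σ = n) :
    ∃ p : n.Partition, n + p.parts.card ≤ d ∧ p.parts.map (· + 1) = σ.cycleType := by
  have h1 := map_pred_map_add_one (s := σ.cycleType) fun x hx =>
    zero_lt_two.trans_le (Perm.two_le_of_mem_cycleType hx)
  have h2 := sum_map_add_one (σ.cycleType.map (· - 1))
  have h3 := norm_add_card_cycleType σ
  have h4 := Perm.sum_cycleType_le σ
  rw [h1, Perm.sum_cycleType, Multiset.card_map] at h2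
  rw [Perm.sum_cycleType, Fintype.card_fin] at h4
  refine ⟨⟨σ.cycleType.map (· - 1), fun {i} hi => ?_, by omega⟩, ?_, h1⟩
  · obtain ⟨x, hx, rfl⟩ := Multiset.mem_map.mp hi
    have := Perm.two_le_of_mem_cycleType hx
    omega
  · rw [Multiset.card_map]
    omega

theorem exists_perm_of_partition {n : ℕ} (p : n.Partition) (hp : n + p.parts.card ≤ d) :
    ∃ σ : Perm (Fin d), norm σ = n ∧ σ.cycleType = p.parts.map (· + 1) := by
  obtain ⟨σ, hσ⟩ := (Perm.exists_with_cycleType_iff (Fin d) (m := p.parts.map (· + 1))).mpr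
    ⟨by rwa [sum_map_add_one, p.parts_sum, Fintype.card_fin], fun a ha => by
      obtain ⟨x, hx, rfl⟩ := Multiset.mem_map.mp ha
      exact Nat.succ_le_succ (p.parts_pos hx)⟩
  refine ⟨σ, ?_, hσ⟩
  have h := norm_add_card_cycleType σ
  rw [← Perm.sum_cycleType, hσ, sum_map_add_one, Multiset.card_map, p.parts_sum] at h
  omega

/-- An invariant is determined by its values at one permutation per class, and the class sums
realise any prescribed values. -/
theorem finrank_homogeneousInvariants (n : ℕ) :
    Module.finrank ℚ (homogeneousInvariants d n) =
      (Finset.univ.filter fun p : n.Partition => n + p.parts.card ≤ d).card := by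
  choose r hrn hrc using fun p : {p : n.Partition // n + p.parts.card ≤ d} =>
    exists_perm_of_partition p.1 p.2
  let F : homogeneousInvariants d n →ₗ[ℚ] {p : n.Partition // n + p.parts.card ≤ d} → ℚ :=
    { toFun := fun f p => f.1 (r p)
      map_add' := fun f g => rfl
      map_smul' := fun c f => rfl }
  have hF : Function.Bijective F := by
    constructor
    · rw [← LinearMap.ker_eq_bot, LinearMap.ker_eq_bot']
      intro f hf
      refine Subtype.ext (Gr.ext fun σ => ?_)
      by_cases hσ : norm σ = n
      · obtain ⟨p, hp, hpc⟩ := exists_partition_of_norm_eq hσ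
        rw [Gr.mem_A_iff.mp f.2.2 σ (r ⟨p, hp⟩) (by rw [hrc, hpc])]
        exact congrFun hf ⟨p, hp⟩
      · exact f.2.1 σ hσ
    · intro g
      refine ⟨⟨∑ p, g p • Gr.classSum d (p.1.parts.map (· + 1)), fun σ hσ => ?_, ?_⟩, ?_⟩
      · rw [Gr.sum_apply]
        refine Finset.sum_eq_zero fun p _ => ?_
        rw [Gr.smul_apply, Gr.classSum_apply, if_neg, mul_zero]
        intro h
        have h1 := norm_add_card_cycleType σ
        rw [← Perm.sum_cycleType, h, sum_map_add_one, Multiset.card_map, p.1.parts_sum] at h1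
        omega
      · exact Submodule.sum_mem _ fun p _ => Submodule.smul_mem _ _ (Gr.classSum_mem _)
      · funext q
        change (∑ p, g p • Gr.classSum d (p.1.parts.map (· + 1)) : Gr d) (r q) = g q
        rw [Gr.sum_apply, Finset.sum_eq_single q]
        · rw [Gr.smul_apply, Gr.classSum_apply, hrc, if_pos rfl, mul_one]
        · intro p _ hp
          rw [Gr.smul_apply, Gr.classSum_apply, hrc, if_neg, mul_zero]
          intro h
          have h1 := Multiset.map_injective (add_left_injective 1) h
          exact hp (Subtype.ext (Nat.Partition.ext h1.symm))
        · simp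
  rw [(LinearEquiv.ofBijective F hF).finrank_eq, Module.finrank_fintype_fun_eq_card,
    Fintype.card_subtype]

end Dimension

/-! ### Relations and minimal relations -/

section Relations

variable {d : ℕ}

theorem presentation_monomial_mem (e : Fin (d / 2) →₀ ℕ) (c : ℚ) :
    (presentation d (MvPolynomial.monomial e c) : Gr d) ∈
      Gr.homogeneous d (Finsupp.weight (weight d) e) := by
  have h1 : (presentation d (MvPolynomial.monomial e 1) : Gr d) ∈
      Gr.homogeneous d (Finsupp.weight (weight d) e) := by
    induction e using Finsupp.induction_linear with
    | zero =>
      rw [map_zero]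
      have : (MvPolynomial.monomial 0 1 : Poly d) = 1 := rfl
      rw [this, map_one]
      exact Gr.one_mem_homogeneous
    | add e f he hf =>
      have : (MvPolynomial.monomial (e + f) 1 : Poly d) =
          MvPolynomial.monomial e 1 * MvPolynomial.monomial f 1 := by
        rw [MvPolynomial.monomial_mul, one_mul]
      rw [this, map_mul, map_add]
      exact Gr.mul_mem_homogeneous he hf
    | single k n =>
      rw [← MvPolynomial.X_pow_eq_monomial, map_pow, Finsupp.weight_single, smul_eq_mul]
      change ((presentation d (MvPolynomial.X k) : A d) : Gr d) ^ n ∈ _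
      rw [presentation, MvPolynomial.aeval_X]
      exact Gr.pow_mem_homogeneous (Gr.delta_mem_homogeneous _) n
  have h2 : MvPolynomial.monomial e c = c • (MvPolynomial.monomial e 1 : Poly d) := by
    rw [MvPolynomial.smul_monomial, smul_eq_mul, mul_one]
  rw [h2, map_smul]
  exact Submodule.smul_mem _ c h1

/-- The presentation as a linear map to `Gr d`. -/
noncomputable def presentationLinear (d : ℕ) : Poly d →ₗ[ℚ] Gr d :=
  ((A d).val.comp (presentation d)).toLinearMap

theorem presentationLinear_apply (p : Poly d) : presentationLinear d p = presentation d p := rfl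

theorem presentationLinear_eq_zero_iff (p : Poly d) :
    presentationLinear d p = 0 ↔ p ∈ relations d := by
  rw [presentationLinear_apply, relations, RingHom.mem_ker]
  exact ZeroMemClass.coe_eq_zero

theorem component_presentation (n : ℕ) (p : Poly d) :
    Gr.component n (presentationLinear d p) =
      presentationLinear d (MvPolynomial.weightedHomogeneousComponent (weight d) n p) := by
  induction p using MvPolynomial.induction_on' with
  | monomial e c =>
    have h1 := Gr.component_of_mem (n := n) (presentation_monomial_mem e c)
    rw [presentationLinear_apply, h1]
    split_ifs with h
    · rw [MvPolynomial.IsWeightedHomogeneous.weightedHomogeneousComponent_same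
        (MvPolynomial.isWeightedHomogeneous_monomial _ _ _ h), presentationLinear_apply]
    · rw [MvPolynomial.IsWeightedHomogeneous.weightedHomogeneousComponent_ne n
        (MvPolynomial.isWeightedHomogeneous_monomial _ _ _ rfl) (Ne.symm h), map_zero]
  | add p q hp hq => rw [map_add, map_add, hp, hq, map_add, map_add]

/-- The part of norm `n` of the presentation. -/
noncomputable def presentationHomogeneous (d n : ℕ) :
    MvPolynomial.weightedHomogeneousSubmodule ℚ (weight d) n →ₗ[ℚ] Gr d :=
  (presentationLinear d).domRestrict _

theorem range_presentationHomogeneous (n : ℕ) :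
    LinearMap.range (presentationHomogeneous d n) = homogeneousInvariants d n := by
  apply le_antisymm
  · rintro _ ⟨⟨p, hp⟩, rfl⟩
    refine ⟨?_, (presentation d p).2⟩
    have h := component_presentation n p
    rw [MvPolynomial.IsWeightedHomogeneous.weightedHomogeneousComponent_same hp] at h
    change presentationLinear d p ∈ Gr.homogeneous d n
    rw [← h]
    exact Gr.component_mem _ _
  · rintro f ⟨hf1, hf2⟩
    obtain ⟨p, hp⟩ := presentation_surjective d ⟨f, hf2⟩
    refine ⟨⟨_, MvPolynomial.weightedHomogeneousComponent_mem (weight d) p n⟩, ?_⟩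
    change presentationLinear d
      (MvPolynomial.weightedHomogeneousComponent (weight d) n p) = f
    rw [← component_presentation, presentationLinear_apply, hp]
    exact (Gr.component_of_mem hf1).trans (if_pos rfl)

theorem finrank_ker_presentationHomogeneous (n : ℕ) :
    (Finset.univ.filter fun p : n.Partition => n + p.parts.card ≤ d).card +
      Module.finrank ℚ (LinearMap.ker (presentationHomogeneous d n)) =
      (Finset.univ.filter fun p : n.Partition => ∀ x ∈ p.parts, x ≤ d / 2).card := by
  rw [← finrank_weightedHomogeneousSubmodule, ← finrank_homogeneousInvariants,
    ← range_presentationHomogeneous, LinearMap.finrank_range_add_finrank_ker]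

/-- The relations that are homogeneous of norm `n`. -/
noncomputable def homogeneousRelations (d n : ℕ) : Submodule ℚ (relations d) :=
  (MvPolynomial.weightedHomogeneousSubmodule ℚ (weight d) n).comap
    ((relations d).subtype.restrictScalars ℚ)

theorem finrank_homogeneousRelations (n : ℕ) :
    Module.finrank ℚ (homogeneousRelations d n) =
      Module.finrank ℚ (LinearMap.ker (presentationHomogeneous d n)) := by
  have h : (homogeneousRelations d n).map ((relations d).subtype.restrictScalars ℚ) =
      (LinearMap.ker (presentationHomogeneous d n)).map (Submodule.subtype _) := by
    ext p
    constructor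
    · rintro ⟨⟨q, hq⟩, hw, rfl⟩
      exact ⟨⟨q, hw⟩, (presentationLinear_eq_zero_iff q).mpr hq, rfl⟩
    · rintro ⟨⟨q, hq⟩, hw, rfl⟩
      exact ⟨⟨q, (presentationLinear_eq_zero_iff q).mp hw⟩, hq, rfl⟩
  rw [(Submodule.equivMapOfInjective ((relations d).subtype.restrictScalars ℚ)
      Subtype.val_injective (homogeneousRelations d n)).finrank_eq, h,
    ← (Submodule.equivMapOfInjective (Submodule.subtype _) Subtype.val_injective
      (LinearMap.ker (presentationHomogeneous d n))).finrank_eq]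

instance (n : ℕ) : Module.Finite ℚ (homogeneousRelations d n) :=
  Module.Finite.of_injective
    ((((relations d).subtype.restrictScalars ℚ).domRestrict (homogeneousRelations d n)).codRestrict
      (MvPolynomial.weightedHomogeneousSubmodule ℚ (weight d) n) fun x => x.2)
    fun _ _ h => Subtype.ext (Subtype.ext (Subtype.mk.inj h))

/-- The map to `Gr d` respects norms, so each homogeneous component of a relation is again a
relation, and there are none below n. -/
theorem coeff_eq_zero_of_mem_relations {n : ℕ}
    (hn : ∀ k < n, Module.finrank ℚ (homogeneousRelations d k) = 0) {p : Poly d}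
    (hp : p ∈ relations d) {e : Fin (d / 2) →₀ ℕ} (he : Finsupp.weight (weight d) e < n) :
    p.coeff e = 0 := by
  have h1 : MvPolynomial.weightedHomogeneousComponent (weight d)
      (Finsupp.weight (weight d) e) p ∈ relations d := by
    rw [← presentationLinear_eq_zero_iff, ← component_presentation,
      (presentationLinear_eq_zero_iff p).mpr hp, map_zero]
  have h2 := Submodule.finrank_eq_zero.mp (hn _ he)
  have h3 : (⟨_, h1⟩ : relations d) ∈ homogeneousRelations d (Finsupp.weight (weight d) e) :=
    MvPolynomial.weightedHomogeneousComponent_mem _ _ _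
  rw [h2, Submodule.mem_bot] at h3
  have h4 := congrArg (fun q : relations d => (q : Poly d).coeff e) h3
  simpa [MvPolynomial.coeff_weightedHomogeneousComponent] using h4

/-- A factor without constant term raises the norm by at least one, and relations start in norm n,
so the products start above n. -/
theorem coeff_eq_zero_of_mem_positive_smul {n : ℕ}
    (hn : ∀ k < n, Module.finrank ℚ (homogeneousRelations d k) = 0) {x : relations d}
    (hx : x ∈ positive d • (⊤ : Submodule (Poly d) (relations d))) {e : Fin (d / 2) →₀ ℕ}
    (he : Finsupp.weight (weight d) e ≤ n) : (x : Poly d).coeff e = 0 := by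
  induction hx using Submodule.smul_induction_on' with
  | smul r hr y hy =>
    change (r * (y : Poly d)).coeff e = 0
    rw [MvPolynomial.coeff_mul]
    refine Finset.sum_eq_zero fun q hq => ?_
    rw [Finset.HasAntidiagonal.mem_antidiagonal] at hq
    by_cases h1 : q.1 = 0
    · have h2 : r.coeff 0 = 0 := hr
      rw [h1, h2, zero_mul]
    · have h2 : Finsupp.weight (weight d) q.1 ≠ 0 := fun h => by
        apply h1
        ext k
        have h3 := Finsupp.le_weight (weight d) (weight_ne_zero k) q.1
        rw [h] at h3
        simpa using h3
      have h3 : Finsupp.weight (weight d) q.1 + Finsupp.weight (weight d) q.2 =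
          Finsupp.weight (weight d) e := by rw [← map_add, hq]
      rw [coeff_eq_zero_of_mem_relations hn y.2 (by omega), mul_zero]
  | add x _ y _ hx hy =>
    change ((x : Poly d) + (y : Poly d)).coeff e = 0
    rw [MvPolynomial.coeff_add, hx, hy, add_zero]

theorem finrank_minimalRelations {n : ℕ}
    (hn : ∀ k < n, Module.finrank ℚ (homogeneousRelations d k) = 0) :
    Module.finrank ℚ (minimalRelations d n) = Module.finrank ℚ (homogeneousRelations d n) := by
  let q : relations d →ₗ[ℚ] MinimalRelations d :=
    (positive d • (⊤ : Submodule (Poly d) (relations d))).mkQ.restrictScalars ℚ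
  have hinj : Function.Injective (q.domRestrict (homogeneousRelations d n)) := by
    refine (injective_iff_map_eq_zero _).mpr ?_
    rintro ⟨x, hx⟩ h
    have h1 : x ∈ positive d • (⊤ : Submodule (Poly d) (relations d)) :=
      (Submodule.Quotient.mk_eq_zero _).mp h
    refine Subtype.ext (Subtype.ext (MvPolynomial.ext _ _ fun e => ?_))
    change (x : Poly d).coeff e = 0
    by_cases he : Finsupp.weight (weight d) e = n
    · exact coeff_eq_zero_of_mem_positive_smul hn h1 he.le
    · exact MvPolynomial.IsWeightedHomogeneous.coeff_eq_zero hx e he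
  have h1 : minimalRelations d n = LinearMap.range (q.domRestrict (homogeneousRelations d n)) := by
    rw [LinearMap.range_domRestrict]
    rfl
  rw [h1, LinearMap.finrank_range_of_inj hinj]

theorem minimalRelations_eq_bot {n : ℕ}
    (hn : Module.finrank ℚ (homogeneousRelations d n) = 0) : minimalRelations d n = ⊥ := by
  have h : homogeneousRelations d n = ⊥ := Submodule.finrank_eq_zero.mp hn
  change (homogeneousRelations d n).map _ = ⊥
  rw [h, Submodule.map_bot]

theorem isLeast_and_finrank_minimalRelations {n r : ℕ}
    (hn : ∀ k < n, Module.finrank ℚ (homogeneousRelations d k) = 0)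
    (hr : Module.finrank ℚ (homogeneousRelations d n) = r) (h0 : r ≠ 0) :
    IsLeast {k : ℕ | minimalRelations d k ≠ ⊥} n ∧
      Module.finrank ℚ (minimalRelations d n) = r := by
  have h1 := (finrank_minimalRelations hn).trans hr
  refine ⟨⟨fun h => ?_, fun k hk => ?_⟩, h1⟩
  · rw [h, finrank_bot] at h1
    exact h0 h1.symm
  · by_contra h
    exact hk (minimalRelations_eq_bot (hn k (not_le.mp h)))

theorem finrank_homogeneousRelations_add_card (n : ℕ) :
    Module.finrank ℚ (homogeneousRelations d n) +
        (Finset.univ.filter fun p : n.Partition => ¬∀ x ∈ p.parts, x ≤ d / 2).card =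
      (Finset.univ.filter fun p : n.Partition => d < n + p.parts.card).card := by
  have h1 := finrank_ker_presentationHomogeneous (d := d) n
  have h2 := Finset.card_filter_add_card_filter_not (s := (Finset.univ : Finset n.Partition))
    fun p => ∀ x ∈ p.parts, x ≤ d / 2
  have h3 := Finset.card_filter_add_card_filter_not (s := (Finset.univ : Finset n.Partition))
    fun p => n + p.parts.card ≤ d
  simp only [not_le] at h3
  rw [finrank_homogeneousRelations]
  omega

theorem card_parts_le {n : ℕ} (p : n.Partition) : p.parts.card ≤ n := by
  have := card_le_sum_of_pos fun x hx => p.parts_pos hx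
  rwa [p.parts_sum] at this

theorem finrank_homogeneousRelations_of_two_mul_le {n : ℕ} (h : 2 * n ≤ d) :
    Module.finrank ℚ (homogeneousRelations d n) = 0 := by
  have h1 := finrank_homogeneousRelations_add_card (d := d) n
  have h2 : (Finset.univ.filter fun p : n.Partition => d < n + p.parts.card) = ∅ :=
    Finset.filter_eq_empty_iff.mpr fun p _ => by
      have := card_parts_le p
      omega
  rw [h2, Finset.card_empty] at h1
  omega

/-- A partition of n has at most n parts, so none satisfies n + length > d. -/
theorem finrank_homogeneousRelations_even {m : ℕ} (hm : 1 ≤ m) :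
    Module.finrank ℚ (homogeneousRelations (2 * m) (m + 1)) = 1 := by
  have h1 := finrank_homogeneousRelations_add_card (d := 2 * m) (m + 1)
  have h2 : ∀ p : (m + 1).Partition, 2 * m < m + 1 + p.parts.card ↔ m + 1 ≤ p.parts.card + 1 :=
    fun p => by omega
  simp only [h2, Nat.mul_div_cancel_left m two_pos] at h1
  rw [card_partition_exists_part_ge, card_partition_le_card_parts_add_one (by omega)] at h1
  omega

theorem finrank_homogeneousRelations_odd_eq_zero (m : ℕ) :
    Module.finrank ℚ (homogeneousRelations (2 * m + 1) (m + 1)) = 0 := by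
  have h1 := finrank_homogeneousRelations_add_card (d := 2 * m + 1) (m + 1)
  have h2 : ∀ p : (m + 1).Partition, 2 * m + 1 < m + 1 + p.parts.card ↔ m + 1 ≤ p.parts.card :=
    fun p => by omega
  have h3 : (2 * m + 1) / 2 = m := by omega
  simp only [h2, h3] at h1
  rw [card_partition_exists_part_ge, card_partition_le_card_parts] at h1
  omega

theorem finrank_homogeneousRelations_odd {m : ℕ} (hm : 2 ≤ m) :
    Module.finrank ℚ (homogeneousRelations (2 * m + 1) (m + 2)) = 2 := by
  have h1 := finrank_homogeneousRelations_add_card (d := 2 * m + 1) (m + 2)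
  have h2 : ∀ p : (m + 2).Partition,
      2 * m + 1 < m + 2 + p.parts.card ↔ m + 2 ≤ p.parts.card + 2 := fun p => by omega
  have h3 : (2 * m + 1) / 2 = m := by omega
  simp only [h2, h3] at h1
  rw [card_partition_add_two_exists_part_ge,
    card_partition_le_card_parts_add_two (by omega)] at h1
  omega

end Relations

end SymGraded

theorem mainTheorem3 :
    (∀ m : ℕ, 1 ≤ m →
      Function.Surjective (SymGraded.presentation (2 * m)) ∧
      IsLeast {n : ℕ | SymGraded.minimalRelations (2 * m) n ≠ ⊥} (m + 1) ∧
      Module.finrank ℚ (SymGraded.minimalRelations (2 * m) (m + 1)) = 1) ∧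
    (∀ m : ℕ, 2 ≤ m →
      Function.Surjective (SymGraded.presentation (2 * m + 1)) ∧
      IsLeast {n : ℕ | SymGraded.minimalRelations (2 * m + 1) n ≠ ⊥} (m + 2) ∧
      Module.finrank ℚ (SymGraded.minimalRelations (2 * m + 1) (m + 2)) = 2) := by
  refine ⟨fun m hm => ⟨SymGraded.presentation_surjective _, ?_⟩,
    fun m hm => ⟨SymGraded.presentation_surjective _, ?_⟩⟩
  · refine SymGraded.isLeast_and_finrank_minimalRelations (fun k hk => ?_)
      (SymGraded.finrank_homogeneousRelations_even hm) one_ne_zero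
    exact SymGraded.finrank_homogeneousRelations_of_two_mul_le (by omega)
  · refine SymGraded.isLeast_and_finrank_minimalRelations (fun k hk => ?_)
      (SymGraded.finrank_homogeneousRelations_odd hm) two_ne_zero
    rcases (Nat.lt_succ_iff.mp hk).eq_or_lt with rfl | hk
    · exact SymGraded.finrank_homogeneousRelations_odd_eq_zero m
    · exact SymGraded.finrank_homogeneousRelations_of_two_mul_le (by omega)
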